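/- Let $G=(V,E)$ be a simple, connected, locally finite graph with a finite or countably infinite vertex set $V$ and at least one edge, and let $\mathcal G$ be the equilateral metric graph over $G$, obtained by identifying every edge $e\in E$ with the interval $[0,1]$. The Hilbert space $L^2(\mathcal G)$ is the orthogonal sum of the complex spaces $L^2(e)=L^2([0,1])$, $e\in E$. Let $\mathbf H$ be the Kirchhoff Laplacian, that is, the unbounded operator $\mathbf Hf=-(f_e'')_{e\in E}$ in $L^2(\mathcal G)$ whose domain consists of all $f\in L^2(\mathcal G)$ such that $f$ is continuous on $\mathcal G$; every restriction $f_e=f|_e$ belongs to $H^2([0,1])$ (it is continuously differentiable on $[0,1]$ and its distributional second derivative $f_e''$ is in $L^2$); $\sum_{e\ni v}f_e'(v)=0$ at every vertex $v$, where $f_e'(v)$ is the derivative at $v$ along $e$ in the direction from $v$ into $e$; and $(f_e'')_{e\in E}\in L^2(\mathcal G)$. Let $\mathrm h$ be the normalized Laplacian, that is, the bounded operator $$(\mathrm h\mathbf f)(v)=\frac1{\deg(v)}\sum_{u\sim v}\big(\mathbf f(v)-\mathbf f(u)\big),\qquad v\in V,$$ in $\ell^2(V;\deg)=\{\mathbf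 f\colon V\to\mathbb C \mid \sum_{v}|\mathbf f(v)|^2\deg(v)<\infty\}$. The spectrum of an operator $A$ is the set of all $z\in\mathbb C$ for which $A-z$ does not have a bounded, everywhere defined inverse. If $\lambda\ge 0$ is a real number with $\lambda\ne(\pi n)^2$ for all integers $n\ge 1$, then $$\lambda\in\sigma(\mathbf H)\quad\Longleftrightarrow\quad 1-\cos(\sqrt\lambda)\in\sigma(\mathrm h).$$ -/

import Mathlib

open MeasureTheory
open scoped ENNReal ContDiff

noncomputable section

namespace QuantumGraph

/-! ### Spectrum of an unbounded operator -/

/-- The resolvent set of a linear operator `A : dom A ⊆ H → H`: the set of all `z` such that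
`A - z` has a bounded inverse `R` which is defined everywhere on `H`. -/
def opResolventSet {H : Type*} [NormedAddCommGroup H] [InnerProductSpace ℂ H]
    (A : H →ₗ.[ℂ] H) : Set ℂ :=
  {z | ∃ R : H →L[ℂ] H,
    (∀ y : H, ∃ x : A.domain, (x : H) = R y ∧ A x - z • (x : H) = y) ∧
    (∀ x : A.domain, R (A x - z • (x : H)) = x)}

/-- The spectrum of a linear operator `A : dom A ⊆ H → H`. -/
def opSpectrum {H : Type*} [NormedAddCommGroup H] [InnerProductSpace ℂ H]
    (A : H →ₗ.[ℂ] H) : Set ℂ :=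
  (opResolventSet A)ᶜ

/-! ### The normalized Laplacian of a locally finite graph -/

section Discrete

variable {V : Type*} (G : SimpleGraph V) [G.LocallyFinite]

/-- The difference expression
`(h f) v = (1 / deg v) * ∑ u ∼ v, (f v - f u)`. -/
def normLap (f : V → ℂ) (v : V) : ℂ :=
  (1 / (G.degree v : ℂ)) * ∑ u ∈ G.neighborFinset v, (f v - f u)

theorem degree_ne_zero_of_adj {v u : V} (h : G.Adj v u) : G.degree u ≠ 0 :=
  (Finset.card_pos.2 ⟨v, by simpa using h.symm⟩).ne'

theorem degree_mul_enorm_normLap_le (f : V → ℂ) (v : V) :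
    (G.degree v : ℝ≥0∞) * ‖normLap G f v‖ₑ ^ 2 ≤
      2 * ((G.degree v : ℝ≥0∞) * ‖f v‖ₑ ^ 2) +
        2 * ∑ u ∈ G.neighborFinset v, ‖f u‖ₑ ^ 2 := by
  have key : (G.degree v : ℝ) * ‖normLap G f v‖ ^ 2 ≤
      2 * ((G.degree v : ℝ) * ‖f v‖ ^ 2) + 2 * ∑ u ∈ G.neighborFinset v, ‖f u‖ ^ 2 := by
    have h1 : ‖∑ u ∈ G.neighborFinset v, (f v - f u)‖ ^ 2 ≤
        (G.degree v : ℝ) * ∑ u ∈ G.neighborFinset v, ‖f v - f u‖ ^ 2 := by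
      refine (pow_le_pow_left₀ (norm_nonneg _) (norm_sum_le _ _) 2).trans ?_
      exact sq_sum_le_card_mul_sum_sq
    have h2 : ∑ u ∈ G.neighborFinset v, ‖f v - f u‖ ^ 2 ≤
        2 * ((G.degree v : ℝ) * ‖f v‖ ^ 2) + 2 * ∑ u ∈ G.neighborFinset v, ‖f u‖ ^ 2 := by
      have : ∀ u ∈ G.neighborFinset v, ‖f v - f u‖ ^ 2 ≤ 2 * ‖f v‖ ^ 2 + 2 * ‖f u‖ ^ 2 := by
        intro u _
        have := pow_le_pow_left₀ (norm_nonneg _) (norm_sub_le (f v) (f u)) 2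
        nlinarith [sq_nonneg (‖f v‖ - ‖f u‖)]
      refine (Finset.sum_le_sum this).trans (le_of_eq ?_)
      rw [Finset.sum_add_distrib, Finset.sum_const, ← Finset.mul_sum, nsmul_eq_mul,
        SimpleGraph.card_neighborFinset_eq_degree]
      ring
    refine le_trans ?_ h2
    by_cases hd : G.degree v = 0
    · simp only [hd, Nat.cast_zero, zero_mul]
      exact Finset.sum_nonneg fun _ _ => sq_nonneg _
    · have hd' : (0 : ℝ) < G.degree v := by exact_mod_cast Nat.pos_of_ne_zero hd
      rw [normLap, norm_mul, norm_div, norm_one, Complex.norm_natCast, mul_pow]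
      calc (G.degree v : ℝ) * ((1 / (G.degree v : ℝ)) ^ 2 *
            ‖∑ u ∈ G.neighborFinset v, (f v - f u)‖ ^ 2)
          = (1 / (G.degree v : ℝ)) * ‖∑ u ∈ G.neighborFinset v, (f v - f u)‖ ^ 2 := by
            field_simp
        _ ≤ (1 / (G.degree v : ℝ)) *
            ((G.degree v : ℝ) * ∑ u ∈ G.neighborFinset v, ‖f v - f u‖ ^ 2) := by gcongr
        _ = _ := by field_simp
  have e : ∀ z : ℂ, ‖z‖ₑ ^ 2 = ENNReal.ofReal (‖z‖ ^ 2) := fun z => by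
    rw [ENNReal.ofReal_pow (norm_nonneg _), ofReal_norm]
  have hdeg : (G.degree v : ℝ≥0∞) = ENNReal.ofReal (G.degree v : ℝ) := by simp
  have h2 : (2 : ℝ≥0∞) = ENNReal.ofReal 2 := by simp
  simp only [e, hdeg, h2]
  rw [← ENNReal.ofReal_sum_of_nonneg (fun _ _ => sq_nonneg _),
    ← ENNReal.ofReal_mul (by positivity), ← ENNReal.ofReal_mul (by positivity),
    ← ENNReal.ofReal_mul (by positivity), ← ENNReal.ofReal_mul (by positivity),
    ← ENNReal.ofReal_add (by positivity)
      (mul_nonneg (by norm_num) (Finset.sum_nonneg fun _ _ => sq_nonneg _))]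
  exact ENNReal.ofReal_le_ofReal key

theorem tsum_sum_neighbor (F : V → ℝ≥0∞) :
    ∑' v : V, ∑ u ∈ G.neighborFinset v, F u = ∑' u : V, (G.degree u : ℝ≥0∞) * F u := by
  classical
  have h1 : ∀ v : V, ∑ u ∈ G.neighborFinset v, F u = ∑' u : V, if G.Adj v u then F u else 0 := by
    intro v
    rw [tsum_eq_sum (s := G.neighborFinset v)]
    · refine Finset.sum_congr rfl fun u hu => ?_
      rw [if_pos (by simpa using hu)]
    · intro u hu
      rw [if_neg (by simpa using hu)]
  simp only [h1]
  rw [ENNReal.tsum_comm]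
  refine tsum_congr fun u => ?_
  rw [tsum_eq_sum (s := G.neighborFinset u)]
  · rw [← SimpleGraph.card_neighborFinset_eq_degree, ← nsmul_eq_mul, ← Finset.sum_const]
    refine Finset.sum_congr rfl fun v hv => ?_
    rw [if_pos (by simpa using (show G.Adj u v by simpa using hv).symm)]
  · intro v hv
    rw [if_neg fun hvu => hv (by simpa using hvu.symm)]

variable [MeasurableSpace V]

/-- The measure on the (discrete) vertex set which gives every vertex `v` the mass `deg v`. -/
def degMeasure : Measure (V) :=
  Measure.sum fun v : V => (G.degree v : ℝ≥0∞) • Measure.dirac v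

/-- The Hilbert space `ℓ²(V; deg)`, with the inner product `∑ v, deg v * f v * conj (g v)`. -/
abbrev VertexL2 : Type _ := Lp ℂ 2 (degMeasure G)

theorem lintegral_degMeasure [DiscreteMeasurableSpace V] (F : V → ℝ≥0∞) :
    ∫⁻ v, F v ∂(degMeasure G) = ∑' v : V, (G.degree v : ℝ≥0∞) * F v := by
  rw [degMeasure, lintegral_sum_measure]
  refine tsum_congr fun v => ?_
  rw [lintegral_smul_measure, lintegral_dirac]
  rfl

theorem ae_degMeasure [DiscreteMeasurableSpace V] {p : V → Prop} :
    (∀ᵐ v ∂(degMeasure G), p v) ↔ ∀ v : V, G.degree v ≠ 0 → p v := by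
  rw [degMeasure, Measure.ae_sum_iff' MeasurableSet.of_discrete]
  refine forall_congr' fun v => ?_
  by_cases h : G.degree v = 0
  · have h0 : (G.degree v : ℝ≥0∞) = 0 := by exact_mod_cast h
    constructor
    · intro _ h1
      exact absurd h h1
    · intro _
      rw [show (((G.degree v : ℕ) : ℝ≥0∞) • Measure.dirac v : Measure (V)) = 0 from by
        rw [h0, zero_smul]]
      simp
  · have h0 : (G.degree v : ℝ≥0∞) ≠ 0 := by exact_mod_cast h
    rw [Measure.ae_ennreal_smul_measure_iff h0, ae_dirac_eq]
    simp [h]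

theorem normLap_ae_congr [DiscreteMeasurableSpace V] {f g : V → ℂ} (h : ∀ᵐ v ∂(degMeasure G), f v = g v) :
    ∀ v : V, G.degree v ≠ 0 → normLap G f v = normLap G g v := by
  rw [ae_degMeasure G (p := fun v => f v = g v)] at h
  intro v hv
  unfold normLap
  congr 1
  refine Finset.sum_congr rfl fun u hu => ?_
  rw [h v hv, h u (degree_ne_zero_of_adj G (by simpa using hu))]

theorem eLpNorm_normLap_le [DiscreteMeasurableSpace V] (f : V → ℂ) :
    eLpNorm (normLap G f) 2 (degMeasure G) ≤
      2 * eLpNorm f 2 (degMeasure G) := by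
  have key : ∑' v : V, (G.degree v : ℝ≥0∞) * ‖normLap G f v‖ₑ ^ 2 ≤
      4 * ∑' v : V, (G.degree v : ℝ≥0∞) * ‖f v‖ₑ ^ 2 := by
    refine (ENNReal.tsum_le_tsum (degree_mul_enorm_normLap_le G f)).trans (le_of_eq ?_)
    rw [ENNReal.tsum_add, ENNReal.tsum_mul_left, ENNReal.tsum_mul_left,
      tsum_sum_neighbor G (fun u => ‖f u‖ₑ ^ 2), ← add_mul]
    norm_num
  have h : ∀ g : V → ℂ, eLpNorm g 2 (degMeasure G) =
      (∑' v : V, (G.degree v : ℝ≥0∞) * ‖g v‖ₑ ^ 2) ^ (1 / 2 : ℝ) := by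
    intro g
    rw [eLpNorm_eq_lintegral_rpow_enorm_toReal (by norm_num) (by norm_num),
      lintegral_degMeasure]
    simp
  rw [h, h]
  refine (ENNReal.rpow_le_rpow key (by norm_num)).trans (le_of_eq ?_)
  rw [ENNReal.mul_rpow_of_nonneg _ _ (by norm_num)]
  congr 1
  rw [show (4 : ℝ≥0∞) = 2 ^ (2 : ℝ) by norm_num, ← ENNReal.rpow_mul]
  norm_num

theorem memLp_normLap [DiscreteMeasurableSpace V] (f : VertexL2 G) :
    MemLp (normLap G (f : V → ℂ)) 2 (degMeasure G) := by
  refine ⟨(Measurable.of_discrete).aestronglyMeasurable, ?_⟩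
  exact (eLpNorm_normLap_le G _).trans_lt
    (ENNReal.mul_lt_top (by norm_num) (Lp.memLp f).2)

/-- The normalized Laplacian `h` as a bounded operator in `ℓ²(V; deg)`. -/
def normalizedLaplacian [DiscreteMeasurableSpace V] : VertexL2 G →L[ℂ] VertexL2 G :=
  LinearMap.mkContinuous
    { toFun := fun f => (memLp_normLap G f).toLp
      map_add' := by
        intro f g
        apply Lp.ext
        refine (memLp_normLap G (f + g)).coeFn_toLp.trans ?_
        refine Filter.EventuallyEq.trans ?_ (Lp.coeFn_add _ _).symm
        filter_upwards [(memLp_normLap G f).coeFn_toLp, (memLp_normLap G g).coeFn_toLp,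
          (ae_degMeasure G).2 (normLap_ae_congr G (Lp.coeFn_add f g))] with v h1 h2 h3
        rw [h3, Pi.add_apply, h1, h2]
        simp only [normLap, Pi.add_apply]
        rw [← mul_add, ← Finset.sum_add_distrib]
        congr 1
        exact Finset.sum_congr rfl fun u _ => by ring
      map_smul' := by
        intro c f
        apply Lp.ext
        refine (memLp_normLap G (c • f)).coeFn_toLp.trans ?_
        refine Filter.EventuallyEq.trans ?_ (Lp.coeFn_smul _ _).symm
        filter_upwards [(memLp_normLap G f).coeFn_toLp,
          (ae_degMeasure G).2 (normLap_ae_congr G (Lp.coeFn_smul c f))] with v h1 h3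
        rw [h3, Pi.smul_apply, RingHom.id_apply, h1]
        simp only [normLap, Pi.smul_apply, smul_eq_mul]
        simp only [← mul_sub]
        rw [← Finset.mul_sum, mul_left_comm] }
    2 (by
      intro f
      change ‖(memLp_normLap G f).toLp‖ ≤ _
      rw [Lp.norm_toLp, Lp.norm_def, ← ENNReal.toReal_ofNat, ← ENNReal.toReal_mul]
      exact ENNReal.toReal_mono
        (ENNReal.mul_lt_top (by norm_num) (Lp.memLp f).2).ne (eLpNorm_normLap_le G _))

/-- The operator `h` is given by the difference expression. -/
theorem normalizedLaplacian_ae [DiscreteMeasurableSpace V] (f : VertexL2 G) :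
    ∀ᵐ v ∂(degMeasure G), normalizedLaplacian G f v = normLap G (f : V → ℂ) v :=
  (memLp_normLap G f).coeFn_toLp

end Discrete

/-! ### Metric graphs and the Kirchhoff Laplacian -/

/-- A metric graph over the combinatorial graph `G`: every edge `e` has a length in `(0, ∞)` and is
identified with the interval `[0, length e]`; the identification is recorded by the orientation
`orient e` of the edge, `0` being the vertex `(orient e).fst` and `length e` being the vertex
`(orient e).snd`. -/
structure MetricGraph {V : Type*} (G : SimpleGraph V) where
  length : G.edgeSet → ℝ
  length_pos : ∀ e, 0 < length e
  orient : G.edgeSet → G.Dart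
  edge_orient : ∀ e, (orient e).edge = e

/-- `w` is the second derivative of `u` on `(0, L)` in the sense of distributions. -/
def HasWeakSecondDeriv (L : ℝ) (u w : ℝ → ℂ) : Prop :=
  ∀ φ : ℝ → ℝ, ContDiff ℝ ∞ φ → HasCompactSupport φ → tsupport φ ⊆ Set.Ioo 0 L →
    ∫ x in Set.Icc 0 L, deriv (deriv φ) x • u x = ∫ x in Set.Icc 0 L, φ x • w x

theorem eq_zero_of_test {L : ℝ} {w : ℝ → ℂ} (hw : MemLp w 2 (volume.restrict (Set.Icc 0 L)))
    (h : ∀ φ : ℝ → ℝ, ContDiff ℝ ∞ φ → HasCompactSupport φ → tsupport φ ⊆ Set.Ioo 0 L →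
      ∫ x in Set.Icc 0 L, φ x • w x = 0) :
    w =ᵐ[volume.restrict (Set.Icc 0 L)] 0 := by
  have hint : IntegrableOn w (Set.Icc 0 L) :=
    hw.integrable (by norm_num)
  have := isOpen_Ioo.ae_eq_zero_of_integral_contDiff_smul_eq_zero (U := Set.Ioo 0 L)
    (μ := volume) (f := w) ((hint.mono_set Set.Ioo_subset_Icc_self).locallyIntegrableOn)
    (by
      intro φ h1 h2 h3
      rw [← h φ h1 h2 h3]
      symm
      refine setIntegral_eq_integral_of_forall_compl_eq_zero fun x hx => ?_
      rw [image_eq_zero_of_notMem_tsupport (fun hx' => hx (Set.Ioo_subset_Icc_self (h3 hx'))),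
        zero_smul])
  rw [restrict_Ioo_eq_restrict_Icc.symm]
  filter_upwards [ae_restrict_mem measurableSet_Ioo, ae_restrict_of_ae this] with x hx h4
  exact h4 hx

theorem integrable_test {L : ℝ} {φ : ℝ → ℝ} (h1 : Continuous φ) (h2 : HasCompactSupport φ)
    {w : ℝ → ℂ} (hw : MemLp w 2 (volume.restrict (Set.Icc 0 L))) :
    Integrable (fun x => φ x • w x) (volume.restrict (Set.Icc 0 L)) := by
  obtain ⟨C, hC⟩ := h2.exists_bound_of_continuous h1
  exact (hw.integrable (by norm_num)).bdd_smul C h1.aestronglyMeasurable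
    (Filter.Eventually.of_forall hC)

theorem HasWeakSecondDeriv.add {L : ℝ} {u₁ u₂ w₁ w₂ : ℝ → ℂ}
    (hu₁ : MemLp u₁ 2 (volume.restrict (Set.Icc 0 L)))
    (hu₂ : MemLp u₂ 2 (volume.restrict (Set.Icc 0 L)))
    (hw₁ : MemLp w₁ 2 (volume.restrict (Set.Icc 0 L)))
    (hw₂ : MemLp w₂ 2 (volume.restrict (Set.Icc 0 L)))
    (h₁ : HasWeakSecondDeriv L u₁ w₁) (h₂ : HasWeakSecondDeriv L u₂ w₂) :
    HasWeakSecondDeriv L (u₁ + u₂) (w₁ + w₂) := by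
  intro φ a b c
  have a2 : Continuous (deriv (deriv φ)) := by
    have := a.continuous_iteratedDeriv 2 (by norm_cast)
    simpa [iteratedDeriv_succ] using this
  simp only [Pi.add_apply, smul_add]
  rw [integral_add (integrable_test a2 b.deriv.deriv hu₁) (integrable_test a2 b.deriv.deriv hu₂),
    integral_add (integrable_test a.continuous b hw₁) (integrable_test a.continuous b hw₂),
    h₁ φ a b c, h₂ φ a b c]

theorem HasWeakSecondDeriv.smul {L : ℝ} {u w : ℝ → ℂ} (k : ℂ)
    (h : HasWeakSecondDeriv L u w) : HasWeakSecondDeriv L (k • u) (k • w) := by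
  intro φ a b c
  simp only [Pi.smul_apply, smul_comm _ k]
  rw [integral_smul, integral_smul, h φ a b c]

theorem HasWeakSecondDeriv.congr {L : ℝ} {u₁ u₂ w₁ w₂ : ℝ → ℂ}
    (h : HasWeakSecondDeriv L u₁ w₁) (hu : u₁ =ᵐ[volume.restrict (Set.Icc 0 L)] u₂)
    (hw : w₁ =ᵐ[volume.restrict (Set.Icc 0 L)] w₂) : HasWeakSecondDeriv L u₂ w₂ := by
  intro φ a b c
  have e1 : ∫ x in Set.Icc 0 L, deriv (deriv φ) x • u₂ x =
      ∫ x in Set.Icc 0 L, deriv (deriv φ) x • u₁ x :=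
    integral_congr_ae (hu.mono fun x hx => by simp only [hx])
  have e2 : ∫ x in Set.Icc 0 L, φ x • w₂ x = ∫ x in Set.Icc 0 L, φ x • w₁ x :=
    integral_congr_ae (hw.mono fun x hx => by simp only [hx])
  rw [e1, e2, h φ a b c]

namespace MetricGraph

variable {V : Type*} {G : SimpleGraph V} (Γ : MetricGraph G)

/-- A metric graph is equilateral if all its edges have length one. -/
def IsEquilateral : Prop := ∀ e, Γ.length e = 1

/-- The Hilbert space `L²(e) = L²([0, length e])` of complex functions on the edge `e`. -/
abbrev EdgeL2 (e : G.edgeSet) : Type := Lp ℂ 2 (volume.restrict (Set.Icc 0 (Γ.length e)))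

/-- The Hilbert space `L²` of the metric graph, the Hilbert sum of the spaces `L²(e)`. -/
abbrev L2 : Type _ := lp (fun e : G.edgeSet => Γ.EdgeL2 e) 2

/-- The edge underlying a dart (directed edge). -/
def dartEdge (d : G.Dart) : G.edgeSet := ⟨d.edge, d.edge_mem⟩

open Classical in
/-- The derivative of the edgewise function `u` at the vertex `d.fst`, taken along the edge of
the dart `d`, in the direction pointing from `d.fst` into the edge. -/
def outwardDeriv (u : G.edgeSet → ℝ → ℂ) (d : G.Dart) : ℂ :=
  if Γ.orient (dartEdge d) = d then
    derivWithin (u (dartEdge d)) (Set.Icc 0 (Γ.length (dartEdge d))) 0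
  else
    -derivWithin (u (dartEdge d)) (Set.Icc 0 (Γ.length (dartEdge d))) (Γ.length (dartEdge d))

/-- `(f, g)` belongs to the graph of the Kirchhoff Laplacian, as witnessed by the pointwise
defined function with the edge components `u e : [0, length e] → ℂ`: this function represents `f`,
is continuously differentiable on every closed edge, is continuous on the metric graph (the
values at the vertices are given by a function on `V`), fulfils the Kirchhoff condition at every
vertex, and its distributional second derivative on each edge `e` is `- g e`, where `g ∈ L²`. -/
structure IsKirchhoffRep [G.LocallyFinite] (f g : Γ.L2) (u : G.edgeSet → ℝ → ℂ) : Prop where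
  ae_eq : ∀ e, (f e : ℝ → ℂ) =ᵐ[volume.restrict (Set.Icc 0 (Γ.length e))] u e
  contDiffOn : ∀ e, ContDiffOn ℝ 1 (u e) (Set.Icc 0 (Γ.length e))
  continuous : ∃ a : V → ℂ, ∀ e,
    u e 0 = a (Γ.orient e).fst ∧ u e (Γ.length e) = a (Γ.orient e).snd
  kirchhoff : ∀ v : V, ∑ w : G.neighborSet v, Γ.outwardDeriv u (G.dartOfNeighborSet v w) = 0
  secondDeriv : ∀ e, HasWeakSecondDeriv (Γ.length e) (u e) (-(g e : ℝ → ℂ))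

theorem IsKirchhoffRep.memLp [G.LocallyFinite] {f g : Γ.L2} {u : G.edgeSet → ℝ → ℂ}
    (h : Γ.IsKirchhoffRep f g u) (e : G.edgeSet) :
    MemLp (u e) 2 (volume.restrict (Set.Icc 0 (Γ.length e))) :=
  (memLp_congr_ae (h.ae_eq e)).1 (Lp.memLp (f e))

theorem outwardDeriv_add {u₁ u₂ : G.edgeSet → ℝ → ℂ}
    (h₁ : ∀ e, ContDiffOn ℝ 1 (u₁ e) (Set.Icc 0 (Γ.length e)))
    (h₂ : ∀ e, ContDiffOn ℝ 1 (u₂ e) (Set.Icc 0 (Γ.length e))) (d : G.Dart) :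
    Γ.outwardDeriv (u₁ + u₂) d = Γ.outwardDeriv u₁ d + Γ.outwardDeriv u₂ d := by
  have hL := (Γ.length_pos (dartEdge d)).le
  have d₁ := (h₁ (dartEdge d)).differentiableOn (by norm_num)
  have d₂ := (h₂ (dartEdge d)).differentiableOn (by norm_num)
  unfold outwardDeriv
  split_ifs
  · exact derivWithin_add (d₁ _ ⟨le_rfl, hL⟩) (d₂ _ ⟨le_rfl, hL⟩)
  · rw [Pi.add_apply, derivWithin_add (d₁ _ ⟨hL, le_rfl⟩) (d₂ _ ⟨hL, le_rfl⟩), neg_add]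

theorem outwardDeriv_smul (k : ℂ) (u : G.edgeSet → ℝ → ℂ) (d : G.Dart) :
    Γ.outwardDeriv (k • u) d = k * Γ.outwardDeriv u d := by
  unfold outwardDeriv
  split_ifs
  · rw [Pi.smul_apply, derivWithin_const_smul_field, smul_eq_mul]
  · rw [Pi.smul_apply, derivWithin_const_smul_field, smul_eq_mul, mul_neg]

/-- The graph of the Kirchhoff Laplacian `f ↦ - Δ f`, as a subspace of `L² × L²`. -/
def kirchhoffGraph [G.LocallyFinite] : Submodule ℂ (Γ.L2 × Γ.L2) where
  carrier := {p | ∃ u, Γ.IsKirchhoffRep p.1 p.2 u}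
  zero_mem' := by
    refine ⟨0, ⟨fun e => Lp.coeFn_zero _ _ _, fun e => contDiffOn_const, ⟨0, by simp⟩, ?_, ?_⟩⟩
    · intro v
      refine Finset.sum_eq_zero fun w _ => ?_
      have := Γ.outwardDeriv_smul 0 0 (G.dartOfNeighborSet v w)
      simpa using this
    · intro e φ _ _ _
      have : ∫ x in Set.Icc 0 (Γ.length e), φ x • (-((0 : Γ.EdgeL2 e) : ℝ → ℂ)) x =
          ∫ x in Set.Icc 0 (Γ.length e), (0 : ℂ) :=
        integral_congr_ae ((Lp.coeFn_zero ℂ 2 _).mono fun x hx => by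
          simp only [Pi.neg_apply, hx, Pi.zero_apply, neg_zero, smul_zero])
      refine Eq.trans ?_ this.symm
      simp
  add_mem' := by
    rintro ⟨f₁, g₁⟩ ⟨f₂, g₂⟩ ⟨u₁, h₁⟩ ⟨u₂, h₂⟩
    refine ⟨u₁ + u₂, ⟨fun e => ?_, fun e => (h₁.contDiffOn e).add (h₂.contDiffOn e), ?_, ?_, ?_⟩⟩
    · exact (Lp.coeFn_add (f₁ e) (f₂ e)).trans ((h₁.ae_eq e).add (h₂.ae_eq e))
    · obtain ⟨a, ha⟩ := h₁.continuous
      obtain ⟨b, hb⟩ := h₂.continuous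
      exact ⟨a + b, fun e => by simp [(ha e).1, (ha e).2, (hb e).1, (hb e).2]⟩
    · intro v
      simp only [Γ.outwardDeriv_add h₁.contDiffOn h₂.contDiffOn]
      rw [Finset.sum_add_distrib, h₁.kirchhoff v, h₂.kirchhoff v, add_zero]
    · intro e
      refine ((h₁.secondDeriv e).add (h₁.memLp Γ e) (h₂.memLp Γ e) (Lp.memLp (g₁ e)).neg
        (Lp.memLp (g₂ e)).neg (h₂.secondDeriv e)).congr (Filter.EventuallyEq.refl _ _) ?_
      refine Filter.EventuallyEq.trans ?_ (Lp.coeFn_add (g₁ e) (g₂ e)).neg.symm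
      exact Filter.Eventually.of_forall fun x => by simp; ring
  smul_mem' := by
    rintro k ⟨f, g⟩ ⟨u, h⟩
    refine ⟨k • u, ⟨fun e => ?_, fun e => (h.contDiffOn e).const_smul k, ?_, ?_, ?_⟩⟩
    · exact (Lp.coeFn_smul k (f e)).trans ((h.ae_eq e).const_smul k)
    · obtain ⟨a, ha⟩ := h.continuous
      exact ⟨k • a, fun e => by simp [(ha e).1, (ha e).2]⟩
    · intro v
      simp only [Γ.outwardDeriv_smul]
      rw [← Finset.mul_sum, h.kirchhoff v, mul_zero]
    · intro e
      refine ((h.secondDeriv e).smul k).congr (Filter.EventuallyEq.refl _ _) ?_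
      refine Filter.EventuallyEq.trans ?_ (Lp.coeFn_smul k (g e)).neg.symm
      exact Filter.Eventually.of_forall fun x => by simp

/-- The function `- Δ f` is uniquely determined by `f`. -/
theorem kirchhoffGraph_snd_eq_zero [G.LocallyFinite] (p : Γ.L2 × Γ.L2)
    (hp : p ∈ Γ.kirchhoffGraph) (h0 : p.1 = 0) : p.2 = 0 := by
  obtain ⟨f, g⟩ := p
  obtain ⟨u, h⟩ := hp
  simp only at h0 h ⊢
  subst h0
  ext1
  funext e
  apply Lp.ext
  have hz : u e =ᵐ[volume.restrict (Set.Icc 0 (Γ.length e))] 0 :=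
    (h.ae_eq e).symm.trans (Lp.coeFn_zero ℂ 2 _)
  refine Filter.EventuallyEq.trans ?_ (Lp.coeFn_zero ℂ 2 _).symm
  refine eq_zero_of_test (Lp.memLp (g e)) fun φ a b c => ?_
  have := h.secondDeriv e φ a b c
  have e1 : ∫ x in Set.Icc 0 (Γ.length e), deriv (deriv φ) x • u e x =
      ∫ x in Set.Icc 0 (Γ.length e), (0 : ℂ) :=
    integral_congr_ae (hz.mono fun x hx => by simp [hx])
  rw [e1] at this
  simpa [integral_neg] using this.symm

/-- The Kirchhoff Laplacian `f ↦ - Δ f`, an unbounded operator in the Hilbert space `L²`. -/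
def kirchhoffLaplacian [G.LocallyFinite] : Γ.L2 →ₗ.[ℂ] Γ.L2 :=
  Γ.kirchhoffGraph.toLinearPMap

theorem mem_graph_kirchhoffLaplacian [G.LocallyFinite] (f g : Γ.L2) :
    (f, g) ∈ Γ.kirchhoffLaplacian.graph ↔ ∃ u, Γ.IsKirchhoffRep f g u := by
  rw [kirchhoffLaplacian, Submodule.toLinearPMap_graph_eq _ Γ.kirchhoffGraph_snd_eq_zero]
  rfl

end MetricGraph

end QuantumGraph

end

namespace QuantumGraph

/-! ### Absolutely continuous functions on the unit interval -/

/-! The equation `(H - lam) f = g` on the metric graph is equivalent to an equation on the vertices.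
Let `C`, `S` be the solutions of `u'' = -lam * u` with `C 0 = 1`, `C' 0 = 0`, `S 0 = 0`, `S' 0 = 1`,
so that `C 1 = cos √lam`. The excluded values of `lam` are the Dirichlet eigenvalues of a unit edge,
hence `S 1 ≠ 0`, and a solution of `-u'' - lam * u = g` on an edge exists for all boundary values
and is determined by them.

Variation of constants shows that `S 1` times the outward derivative at `v`, along the edge to `w`,
is `a w - C 1 * a v` plus an integral of `g`, where `a` is the restriction of `f` to the vertices.
Summing over the neighbors turns the Kirchhoff condition into `(h - (1 - C 1)) a = b`, with `b` the
average of these source integrals (`IsEdgewiseSolution.kirchhoff_iff`).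

To carry bounded invertibility across, three facts are needed besides this identity. The map from
`g` to `b` is bounded (`exists_vertexSource_le`) and onto `ℓ²(V; deg)` (`exists_vertexSource_eq`).
The vertex values are controlled by `f` and `g` (`exists_boundary_le`). Conversely `f` is controlled
by `a` and `g` (`exists_tsum_le_boundary`). The constants are the same for all edges, since all have
length one, and the edge estimates are summed by counting darts in two ways. Self-adjointness plays
no role. -/

/-- `f` is absolutely continuous on `[0, 1]`, with the integrable derivative `f'`. -/
structure IsPrimitive (f f' : ℝ → ℂ) : Prop where
  intervalIntegrable : IntervalIntegrable f' volume 0 1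
  eq_add_integral : ∀ x ∈ Set.Icc (0 : ℝ) 1, f x = f 0 + ∫ t in (0 : ℝ)..x, f' t

theorem absolutelyContinuousOnInterval_integral {f : ℝ → ℂ} {a b : ℝ}
    (hf : IntervalIntegrable f volume a b) :
    AbsolutelyContinuousOnInterval (fun x => ∫ t in a..x, f t) a b := by
  have hre : IntervalIntegrable (fun x => (f x).re) volume a b :=
    ⟨hf.1.re, hf.2.re⟩
  have him : IntervalIntegrable (fun x => (f x).im) volume a b :=
    ⟨hf.1.im, hf.2.im⟩
  have hconst : ∀ z : ℂ, AbsolutelyContinuousOnInterval (fun _ : ℝ => z) a b := fun z =>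
    (contDiffOn_const (n := 1)).absolutelyContinuousOnInterval
  -- The real and imaginary parts are handled separately and recombined with the constants `1` and
  -- `Complex.I`.
  have key := ((hre.absolutelyContinuousOnInterval_intervalIntegral
    (c := a) Set.left_mem_uIcc).fun_smul (hconst 1)).fun_add
    ((him.absolutelyContinuousOnInterval_intervalIntegral
      (c := a) Set.left_mem_uIcc).fun_smul (hconst Complex.I))
  have heq : Set.EqOn (fun x => (∫ t in a..x, (f t).re) • (1 : ℂ) +
      (∫ t in a..x, (f t).im) • Complex.I) (fun x => ∫ t in a..x, f t) (Set.uIcc a b) := by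
    intro x hx
    have hx' : IntervalIntegrable f volume a x :=
      hf.mono_set (Set.uIcc_subset_uIcc Set.left_mem_uIcc hx)
    have h1 : ∫ t in a..x, (f t).re = (∫ t in a..x, f t).re := by
      simpa using Complex.reCLM.intervalIntegral_comp_comm hx'
    have h2 : ∫ t in a..x, (f t).im = (∫ t in a..x, f t).im := by
      simpa using Complex.imCLM.intervalIntegral_comp_comm hx'
    simp only [h1, h2]
    apply Complex.ext <;> simp
  rw [absolutelyContinuousOnInterval_iff] at key ⊢
  intro ε hε
  obtain ⟨δ, hδ, h⟩ := key ε hε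
  refine ⟨δ, hδ, fun E hE hlt => ?_⟩
  have := h E hE hlt
  refine lt_of_le_of_lt (le_of_eq (Finset.sum_congr rfl fun i hi => ?_)) this
  exact congrArg₂ dist (heq (hE.1 i hi).1).symm (heq (hE.1 i hi).2).symm

namespace IsPrimitive

variable {f f' g g' : ℝ → ℂ}

theorem intervalIntegrable_left (hf : IsPrimitive f f') {x : ℝ} (hx : x ∈ Set.Icc (0 : ℝ) 1) :
    IntervalIntegrable f' volume 0 x :=
  hf.intervalIntegrable.mono_set (by
    rw [Set.uIcc_of_le hx.1, Set.uIcc_of_le zero_le_one]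
    exact Set.Icc_subset_Icc_right hx.2)

theorem continuousOn (hf : IsPrimitive f f') : ContinuousOn f (Set.Icc 0 1) := by
  have h1 := (absolutelyContinuousOnInterval_integral hf.intervalIntegrable).continuousOn
  rw [Set.uIcc_of_le zero_le_one] at h1
  exact (continuousOn_const.add h1).congr hf.eq_add_integral

theorem integral_eq (hf : IsPrimitive f f') : ∫ t in (0 : ℝ)..1, f' t = f 1 - f 0 := by
  rw [hf.eq_add_integral 1 ⟨zero_le_one, le_rfl⟩]
  ring

theorem congr_deriv (hf : IsPrimitive f f') (h : ∀ᵐ x, x ∈ Set.Icc (0 : ℝ) 1 → f' x = g' x) :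
    IsPrimitive f g' := by
  refine ⟨hf.intervalIntegrable.congr_ae ?_, fun x hx => ?_⟩
  · rw [Filter.EventuallyEq, ae_restrict_iff' measurableSet_uIoc]
    filter_upwards [h] with x hx hx'
    rw [Set.uIoc_of_le zero_le_one] at hx'
    exact hx ⟨hx'.1.le, hx'.2⟩
  · rw [hf.eq_add_integral x hx]
    congr 1
    refine intervalIntegral.integral_congr_ae ?_
    filter_upwards [h] with y hy hy'
    rw [Set.uIoc_of_le hx.1] at hy'
    exact hy ⟨hy'.1.le, hy'.2.trans hx.2⟩

theorem add (hf : IsPrimitive f f') (hg : IsPrimitive g g') :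
    IsPrimitive (fun x => f x + g x) (fun x => f' x + g' x) := by
  refine ⟨hf.intervalIntegrable.add hg.intervalIntegrable, fun x hx => ?_⟩
  rw [intervalIntegral.integral_add (hf.intervalIntegrable_left hx)
    (hg.intervalIntegrable_left hx), hf.eq_add_integral x hx, hg.eq_add_integral x hx]
  ring

theorem const_mul (hf : IsPrimitive f f') (c : ℂ) :
    IsPrimitive (fun x => c * f x) (fun x => c * f' x) := by
  refine ⟨hf.intervalIntegrable.const_mul c, fun x hx => ?_⟩
  rw [intervalIntegral.integral_const_mul, hf.eq_add_integral x hx]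
  ring

theorem sub (hf : IsPrimitive f f') (hg : IsPrimitive g g') :
    IsPrimitive (fun x => f x - g x) (fun x => f' x - g' x) := by
  have := hf.add (hg.const_mul (-1))
  simpa [sub_eq_add_neg] using this

theorem of_integral (hf : IntervalIntegrable f' volume 0 1) (c : ℂ) :
    IsPrimitive (fun x => c + ∫ t in (0 : ℝ)..x, f' t) f' :=
  ⟨hf, fun x _ => by simp⟩

theorem of_hasDerivAt (h : ∀ x, HasDerivAt f (f' x) x) (hc : Continuous f') :
    IsPrimitive f f' := by
  refine ⟨hc.intervalIntegrable _ _, fun x hx => ?_⟩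
  rw [intervalIntegral.integral_eq_sub_of_hasDerivAt (fun y _ => h y) (hc.intervalIntegrable _ _)]
  ring

/-- The product rule for absolutely continuous functions. -/
theorem mul (hf : IsPrimitive f f') (hg : IsPrimitive g g') :
    IsPrimitive (fun x => f x * g x) (fun x => f' x * g x + f x * g' x) := by
  have hint : IntervalIntegrable (fun x => f' x * g x + f x * g' x) volume 0 1 := by
    refine IntervalIntegrable.add ?_ ?_
    · exact hf.intervalIntegrable.mul_continuousOn
        (by rw [Set.uIcc_of_le zero_le_one]; exact hg.continuousOn)
    · exact hg.intervalIntegrable.continuousOn_mul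
        (by rw [Set.uIcc_of_le zero_le_one]; exact hf.continuousOn)
  refine ⟨hint, ?_⟩
  have hconst : ∀ z : ℂ, AbsolutelyContinuousOnInterval (fun _ : ℝ => z) 0 1 := fun z =>
    (contDiffOn_const (n := 1)).absolutelyContinuousOnInterval
  have hF := (hconst (f 0)).fun_add (absolutelyContinuousOnInterval_integral hf.intervalIntegrable)
  have hG := (hconst (g 0)).fun_add (absolutelyContinuousOnInterval_integral hg.intervalIntegrable)
  -- The product minus the integral of the expected derivative is absolutely continuous with
  -- derivative zero almost everywhere, hence constant. `f` and `g` are replaced by their integral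
  -- representations, since their values outside `[0, 1]` are arbitrary.
  obtain ⟨C, hC⟩ := ((hF.fun_smul hG).fun_sub
    (absolutelyContinuousOnInterval_integral hint)).const_of_ae_hasDerivAt_zero (by
      filter_upwards [hf.intervalIntegrable.ae_hasDerivAt_integral,
        hg.intervalIntegrable.ae_hasDerivAt_integral, hint.ae_hasDerivAt_integral]
        with x h1 h2 h3 hx
      have hx' : x ∈ Set.Icc (0 : ℝ) 1 := by rwa [Set.uIcc_of_le zero_le_one] at hx
      have d := (((h1 hx 0 Set.left_mem_uIcc).const_add (f 0)).mul
        ((h2 hx 0 Set.left_mem_uIcc).const_add (g 0))).sub (h3 hx 0 Set.left_mem_uIcc)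
      rw [← hf.eq_add_integral x hx', ← hg.eq_add_integral x hx', sub_self] at d
      exact d)
  intro x hx
  have e1 := hC x (by rwa [Set.uIcc_of_le zero_le_one])
  have e2 := hC 0 Set.left_mem_uIcc
  simp only [← hf.eq_add_integral x hx, ← hg.eq_add_integral x hx, smul_eq_mul] at e1
  simp only [intervalIntegral.integral_same, add_zero, sub_zero, smul_eq_mul] at e2
  rw [e2, ← e1]
  ring

theorem hasDerivWithinAt (hf : IsPrimitive f f') (hc : ContinuousOn f' (Set.Icc 0 1)) {x : ℝ}
    (hx : x ∈ Set.Icc (0 : ℝ) 1) : HasDerivWithinAt f (f' x) (Set.Icc 0 1) x := by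
  -- This instance selects the version of the fundamental theorem for derivatives within `[0, 1]`,
  -- endpoints included.
  have : Fact (x ∈ Set.Icc (0 : ℝ) 1) := ⟨hx⟩
  have h1 : HasDerivWithinAt (fun y => ∫ t in (0 : ℝ)..y, f' t) (f' x) (Set.Icc 0 1) x :=
    intervalIntegral.integral_hasDerivWithinAt_right (hf.intervalIntegrable_left hx)
      (hc.stronglyMeasurableAtFilter_nhdsWithin measurableSet_Icc x) (hc x hx)
  exact (h1.const_add (f 0)).congr hf.eq_add_integral (hf.eq_add_integral x hx)

theorem contDiffOn (hf : IsPrimitive f f') (hc : ContinuousOn f' (Set.Icc 0 1)) :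
    ContDiffOn ℝ 1 f (Set.Icc 0 1) := by
  have huniq : UniqueDiffOn ℝ (Set.Icc (0 : ℝ) 1) := uniqueDiffOn_Icc zero_lt_one
  rw [show (1 : WithTop ℕ∞) = 0 + 1 by simp, contDiffOn_succ_iff_derivWithin huniq]
  refine ⟨fun x hx => (hf.hasDerivWithinAt hc hx).differentiableWithinAt, by simp, ?_⟩
  rw [contDiffOn_zero]
  exact hc.congr fun x hx => (hf.hasDerivWithinAt hc hx).derivWithin (huniq x hx)

theorem of_contDiffOn (hf : ContDiffOn ℝ 1 f (Set.Icc 0 1)) :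
    IsPrimitive f (derivWithin f (Set.Icc 0 1)) := by
  have hc : ContinuousOn (derivWithin f (Set.Icc 0 1)) (Set.Icc 0 1) :=
    hf.continuousOn_derivWithin (uniqueDiffOn_Icc zero_lt_one) le_rfl
  have hi : IntervalIntegrable (derivWithin f (Set.Icc 0 1)) volume 0 1 :=
    ContinuousOn.intervalIntegrable (by rwa [Set.uIcc_of_le zero_le_one])
  refine ⟨hi, fun x hx => ?_⟩
  have hsub : Set.Icc 0 x ⊆ Set.Icc (0 : ℝ) 1 := Set.Icc_subset_Icc_right hx.2
  rw [intervalIntegral.integral_eq_sub_of_hasDerivAt_of_le hx.1 (f := f)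
    (hf.continuousOn.mono hsub) ?_
    (hi.mono_set (by rw [Set.uIcc_of_le hx.1, Set.uIcc_of_le zero_le_one]; exact hsub))]
  · ring
  · intro y hy
    have hy' : y ∈ Set.Icc (0 : ℝ) 1 := hsub ⟨hy.1.le, hy.2.le⟩
    exact ((hf.differentiableOn (by norm_num) y hy').hasDerivWithinAt).hasDerivAt
      (Icc_mem_nhds hy.1 (hy.2.trans_le hx.2))

end IsPrimitive

/-! ### Weak second derivatives -/

theorem setIntegral_Icc_eq (f : ℝ → ℂ) :
    ∫ x in Set.Icc (0 : ℝ) 1, f x = ∫ x in (0 : ℝ)..1, f x := by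
  rw [integral_Icc_eq_integral_Ioc, intervalIntegral.integral_of_le zero_le_one]

theorem intervalIntegrable_of_memLp {w : ℝ → ℂ}
    (hw : MemLp w 2 (volume.restrict (Set.Icc (0 : ℝ) 1))) :
    IntervalIntegrable w volume 0 1 := by
  rw [intervalIntegrable_iff_integrableOn_Icc_of_le zero_le_one]
  exact hw.integrable (by norm_num)

theorem isPrimitive_ofReal {φ : ℝ → ℝ} (h : ContDiff ℝ 1 φ) :
    IsPrimitive (fun x => (φ x : ℂ)) (fun x => ((deriv φ x : ℝ) : ℂ)) :=
  IsPrimitive.of_hasDerivAt (fun x => ((h.differentiable (by norm_num)) x).hasDerivAt.ofReal_comp)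
    (Complex.continuous_ofReal.comp (h.continuous_deriv le_rfl))

theorem contDiff_infty_deriv {φ : ℝ → ℝ} (h : ContDiff ℝ ∞ φ) : ContDiff ℝ ∞ (deriv φ) :=
  (contDiff_infty_iff_deriv.1 h).2

theorem test_apply_zero {φ : ℝ → ℝ} (h : tsupport φ ⊆ Set.Ioo 0 1) : φ 0 = 0 :=
  image_eq_zero_of_notMem_tsupport fun h' => lt_irrefl _ (h h').1

theorem test_apply_one {φ : ℝ → ℝ} (h : tsupport φ ⊆ Set.Ioo 0 1) : φ 1 = 0 :=
  image_eq_zero_of_notMem_tsupport fun h' => lt_irrefl _ (h h').2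

/-- Integration by parts against a function which vanishes at the boundary. -/
theorem integral_deriv_mul_eq_neg {φ : ℝ → ℝ} (hφ : ContDiff ℝ ∞ φ)
    (hs : tsupport φ ⊆ Set.Ioo 0 1) {f f' : ℝ → ℂ} (hf : IsPrimitive f f') :
    ∫ x in (0 : ℝ)..1, ((deriv φ x : ℝ) : ℂ) * f x = -∫ x in (0 : ℝ)..1, (φ x : ℂ) * f' x := by
  have hp := isPrimitive_ofReal (hφ.of_le (by norm_cast) : ContDiff ℝ 1 φ)
  have h := (hp.mul hf).integral_eq
  rw [intervalIntegral.integral_add] at h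
  · rw [test_apply_zero hs, test_apply_one hs] at h
    rw [eq_neg_iff_add_eq_zero, h]
    simp
  · exact hp.intervalIntegrable.mul_continuousOn
      (by rw [Set.uIcc_of_le zero_le_one]; exact hf.continuousOn)
  · exact hf.intervalIntegrable.continuousOn_mul
      (by rw [Set.uIcc_of_le zero_le_one]; exact hp.continuousOn)

theorem hasWeakSecondDeriv_of_isPrimitive {u v w : ℝ → ℂ} (h₁ : IsPrimitive u v)
    (h₂ : IsPrimitive v w) : HasWeakSecondDeriv 1 u w := by
  intro φ a _ c
  simp only [Complex.real_smul]
  rw [setIntegral_Icc_eq, setIntegral_Icc_eq,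
    integral_deriv_mul_eq_neg (contDiff_infty_deriv a) (tsupport_deriv_subset.trans c) h₁,
    integral_deriv_mul_eq_neg a c h₂, neg_neg]

/-- A test function with integral zero is the derivative of a test function. -/
theorem exists_test_deriv_eq {η : ℝ → ℝ} (hη : ContDiff ℝ ∞ η) (hc : HasCompactSupport η)
    (hs : tsupport η ⊆ Set.Ioo 0 1) (h0 : ∫ x in (0 : ℝ)..1, η x = 0) :
    ∃ φ : ℝ → ℝ, ContDiff ℝ ∞ φ ∧ HasCompactSupport φ ∧ tsupport φ ⊆ Set.Ioo 0 1 ∧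
      deriv φ = η := by
  obtain ⟨a, b, ha, hb, hab⟩ : ∃ a b : ℝ, 0 < a ∧ b < 1 ∧ tsupport η ⊆ Set.Icc a b := by
    rcases (tsupport η).eq_empty_or_nonempty with he | hne
    -- For empty support, `a = 1` and `b = 0` give an empty interval and still satisfy both strict
    -- inequalities.
    · exact ⟨1, 0, one_pos, one_pos, by simp [he]⟩
    · have hk : IsCompact (tsupport η) := hc
      exact ⟨_, _, (hs (hk.sInf_mem hne)).1, (hs (hk.sSup_mem hne)).2,
        fun x hx => ⟨csInf_le hk.bddBelow hx, le_csSup hk.bddAbove hx⟩⟩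
  have hz : ∀ x, x ∉ Set.Icc a b → η x = 0 := fun x hx =>
    image_eq_zero_of_notMem_tsupport fun h => hx (hab h)
  have hcont : Continuous η := hη.continuous
  have hd : deriv (fun x => ∫ t in (0 : ℝ)..x, η t) = η :=
    funext fun x => hcont.deriv_integral _ _ _
  have hsupp : tsupport (fun x => ∫ t in (0 : ℝ)..x, η t) ⊆ Set.Icc a b := by
    refine closure_minimal (fun x hx => ?_) isClosed_Icc
    by_contra hx'
    refine hx ?_
    rcases lt_or_ge x a with hxa | hxa
    · refine (intervalIntegral.integral_congr (g := fun _ => (0 : ℝ)) fun t ht => ?_).trans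
        (by simp)
      refine hz t fun h => ?_
      have : t ≤ max 0 x := ht.2
      exact absurd (h.1.trans this) (not_le.2 (max_lt ha hxa))
    · have hxb : b < x := not_le.1 fun h => hx' ⟨hxa, h⟩
      change ∫ t in (0 : ℝ)..x, η t = 0
      -- To the right of the support the primitive equals the total integral of `η`, which is zero.
      rw [← intervalIntegral.integral_add_adjacent_intervals (b := 1)
        (hcont.intervalIntegrable _ _) (hcont.intervalIntegrable _ _), h0, zero_add]
      refine (intervalIntegral.integral_congr (g := fun _ => (0 : ℝ)) fun t ht => ?_).trans
        (by simp)
      refine hz t fun h => ?_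
      have : min 1 x ≤ t := ht.1
      exact absurd (this.trans h.2) (not_le.2 (lt_min hb hxb))
  refine ⟨fun x => ∫ t in (0 : ℝ)..x, η t, ?_, ?_, ?_, hd⟩
  · rw [contDiff_infty_iff_deriv, hd]
    exact ⟨fun x => (intervalIntegral.integral_hasDerivAt_right (hcont.intervalIntegrable _ _)
      (hcont.stronglyMeasurableAtFilter _ _) hcont.continuousAt).differentiableAt, hη⟩
  · exact HasCompactSupport.of_support_subset_isCompact isCompact_Icc
      (subset_closure.trans hsupp)
  · exact hsupp.trans fun x hx => ⟨ha.trans_le hx.1, hx.2.trans_lt hb⟩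

theorem exists_test_integral_eq_one :
    ∃ ρ : ℝ → ℝ, ContDiff ℝ ∞ ρ ∧ HasCompactSupport ρ ∧ tsupport ρ ⊆ Set.Ioo 0 1 ∧
      ∫ x in (0 : ℝ)..1, ρ x = 1 := by
  let b : ContDiffBump (1 / 2 : ℝ) := ⟨1 / 8, 1 / 4, by norm_num, by norm_num⟩
  have hs : tsupport (b.normed volume) ⊆ Set.Ioo 0 1 := by
    rw [b.tsupport_normed_eq, Real.closedBall_eq_Icc]
    intro x hx
    have h1 := hx.1
    have h2 := hx.2
    simp only [b] at h1 h2
    constructor <;> linarith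
  refine ⟨b.normed volume, b.contDiff_normed, b.hasCompactSupport_normed, hs, ?_⟩
  rw [intervalIntegral.integral_of_le zero_le_one]
  refine (setIntegral_eq_integral_of_forall_compl_eq_zero fun x hx => ?_).trans
    (b.integral_normed (μ := volume))
  exact image_eq_zero_of_notMem_tsupport fun h => hx (Set.Ioo_subset_Ioc_self (hs h))

theorem memLp_of_continuousOn {F : ℝ → ℂ} (hF : ContinuousOn F (Set.Icc 0 1)) :
    MemLp F 2 (volume.restrict (Set.Icc (0 : ℝ) 1)) := by
  obtain ⟨C, hC⟩ := isCompact_Icc.exists_bound_of_continuousOn hF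
  refine MemLp.of_bound (hF.aestronglyMeasurable measurableSet_Icc) C ?_
  filter_upwards [ae_restrict_mem measurableSet_Icc] with x hx using hC x hx

/-- The lemma of du Bois-Reymond. -/
theorem exists_eq_const_of_test {F : ℝ → ℂ} (hF : ContinuousOn F (Set.Icc 0 1))
    (h : ∀ φ : ℝ → ℝ, ContDiff ℝ ∞ φ → HasCompactSupport φ → tsupport φ ⊆ Set.Ioo 0 1 →
      ∫ x in (0 : ℝ)..1, ((deriv φ x : ℝ) : ℂ) * F x = 0) :
    ∃ c, ∀ x ∈ Set.Icc (0 : ℝ) 1, F x = c := by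
  obtain ⟨ρ, hρ, hρc, hρs, hρ1⟩ := exists_test_integral_eq_one
  have hFi : ∀ {ψ : ℝ → ℝ}, Continuous ψ →
      IntervalIntegrable (fun x => (ψ x : ℂ) * F x) volume 0 1 := fun hψ =>
    ContinuousOn.intervalIntegrable (by
      rw [Set.uIcc_of_le zero_le_one]
      exact (Complex.continuous_ofReal.comp hψ).continuousOn.mul hF)
  -- If `F` is constant, its value is its mean against the weight `ρ`.
  set c : ℂ := ∫ x in (0 : ℝ)..1, (ρ x : ℂ) * F x
  refine ⟨c, ?_⟩
  have hFc : ContinuousOn (fun x => F x - c) (Set.Icc 0 1) := hF.sub continuousOn_const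
  have hae := eq_zero_of_test (memLp_of_continuousOn hFc) (by
    intro ψ hψ hψc hψs
    set m : ℝ := ∫ x in (0 : ℝ)..1, ψ x with hm
    have hts : tsupport (fun x => ψ x - m * ρ x) ⊆ tsupport ψ ∪ tsupport ρ := by
      refine closure_minimal (fun x hx => ?_) (isClosed_closure.union isClosed_closure)
      by_contra hx'
      rw [Set.mem_union, not_or] at hx'
      refine hx ?_
      simp [image_eq_zero_of_notMem_tsupport hx'.1, image_eq_zero_of_notMem_tsupport hx'.2]
    -- Subtracting `m * ρ` from `ψ` makes the integral vanish, so the difference is the derivative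
    -- of a test function and the hypothesis applies to it.
    obtain ⟨φ, h1, h2, h3, h4⟩ := exists_test_deriv_eq
      (η := fun x => ψ x - m * ρ x) (hψ.sub (contDiff_const.mul hρ))
      (HasCompactSupport.of_support_subset_isCompact (hψc.isCompact.union hρc.isCompact)
        (subset_closure.trans hts))
      (hts.trans (Set.union_subset hψs hρs))
      (by
        have i2 : IntervalIntegrable (fun x => m * ρ x) volume 0 1 :=
          (continuous_const.mul hρ.continuous).intervalIntegrable _ _
        rw [intervalIntegral.integral_sub (hψ.continuous.intervalIntegrable _ _) i2,
          intervalIntegral.integral_const_mul, hρ1, ← hm]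
        ring)
    have := h φ h1 h2 h3
    rw [h4] at this
    have e1 : ∀ x, ((ψ x - m * ρ x : ℝ) : ℂ) * F x
        = (ψ x : ℂ) * F x - m * ((ρ x : ℂ) * F x) := fun x => by push_cast; ring
    simp only [e1] at this
    rw [intervalIntegral.integral_sub (hFi hψ.continuous) ((hFi hρ.continuous).const_mul _),
      intervalIntegral.integral_const_mul] at this
    rw [setIntegral_Icc_eq]
    simp only [Complex.real_smul, mul_sub]
    have i3 : IntervalIntegrable (fun x => (ψ x : ℂ) * c) volume 0 1 :=
      ((Complex.continuous_ofReal.comp hψ.continuous).mul continuous_const).intervalIntegrable _ _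
    rw [intervalIntegral.integral_sub (hFi hψ.continuous) i3,
      intervalIntegral.integral_mul_const, intervalIntegral.integral_ofReal]
    exact this)
  intro x hx
  exact sub_eq_zero.1 (Measure.eqOn_Icc_of_ae_eq volume zero_ne_one hae hFc continuousOn_const hx)

/-- A continuously differentiable function whose second derivative in the sense of distributions
is square integrable has an absolutely continuous derivative. -/
theorem isPrimitive_derivWithin {u w : ℝ → ℂ} (hu : ContDiffOn ℝ 1 u (Set.Icc 0 1))
    (hw : MemLp w 2 (volume.restrict (Set.Icc (0 : ℝ) 1))) (h : HasWeakSecondDeriv 1 u w) :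
    IsPrimitive (derivWithin u (Set.Icc 0 1)) w := by
  have hwi := intervalIntegrable_of_memLp hw
  have hv : ContinuousOn (derivWithin u (Set.Icc 0 1)) (Set.Icc 0 1) :=
    hu.continuousOn_derivWithin (uniqueDiffOn_Icc zero_lt_one) le_rfl
  have hW := IsPrimitive.of_integral hwi 0
  -- Both `u'` and the primitive of `w` have the distributional derivative `w`, so their difference
  -- is constant by du Bois-Reymond.
  obtain ⟨c, hc⟩ := exists_eq_const_of_test (hv.sub hW.continuousOn) (by
    intro φ h1 h2 h3
    have hφ' : ContinuousOn (fun x => ((deriv φ x : ℝ) : ℂ)) (Set.Icc 0 1) :=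
      (Complex.continuous_ofReal.comp (contDiff_infty_deriv h1).continuous).continuousOn
    simp only [mul_sub, Pi.sub_apply]
    rw [intervalIntegral.integral_sub, integral_deriv_mul_eq_neg h1 h3 hW]
    · have e := integral_deriv_mul_eq_neg (contDiff_infty_deriv h1) (tsupport_deriv_subset.trans h3)
        (IsPrimitive.of_contDiffOn hu)
      have e' := h φ h1 h2 h3
      simp only [Complex.real_smul] at e'
      rw [setIntegral_Icc_eq, setIntegral_Icc_eq] at e'
      rw [sub_neg_eq_add, ← e', e]
      ring
    · exact (hφ'.mul hv).intervalIntegrable_of_Icc zero_le_one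
    · exact (hφ'.mul hW.continuousOn).intervalIntegrable_of_Icc zero_le_one)
  have hc' : ∀ x ∈ Set.Icc (0 : ℝ) 1, derivWithin u (Set.Icc 0 1) x
      = c + ∫ t in (0 : ℝ)..x, w t := fun x hx => by
    have := hc x hx
    simp only [Pi.sub_apply, zero_add] at this
    rw [← this]
    ring
  refine ⟨hwi, fun x hx => ?_⟩
  rw [hc' x hx, hc' 0 ⟨le_rfl, zero_le_one⟩]
  simp

/-! ### The fundamental solutions of `u'' = -lam * u` -/

/-- `C` and `S` are the solutions of `u'' = -lam * u` with `C 0 = 1`, `C' 0 = 0` and `S 0 = 0`,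
`S' 0 = 1`. -/
structure FundamentalPair (lam : ℂ) (C S : ℝ → ℂ) : Prop where
  hasDerivAt_cos : ∀ x, HasDerivAt C (-lam * S x) x
  hasDerivAt_sin : ∀ x, HasDerivAt S (C x) x
  cos_zero : C 0 = 1
  sin_zero : S 0 = 0

/-- For `lam > 0` one has `S 1 = sin √lam / √lam`, which vanishes only at the excluded values. At
`lam = 0` the pair degenerates to `1`, `x`, with `S 1 = 1`, which is why zero is admissible. -/
theorem exists_fundamentalPair {lam : ℝ} (hlam : 0 ≤ lam)
    (hlam' : ∀ n : ℕ, 1 ≤ n → lam ≠ (Real.pi * n) ^ 2) :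
    ∃ C S : ℝ → ℂ, FundamentalPair lam C S ∧ C 1 = (Real.cos (Real.sqrt lam) : ℝ) ∧ S 1 ≠ 0 := by
  rcases hlam.eq_or_lt with h0 | hpos
  · subst h0
    refine ⟨fun _ => 1, fun x => (x : ℂ), ⟨fun x => ?_, fun x => ?_, rfl, by simp⟩, by simp,
      by simp⟩
    · simpa using hasDerivAt_const x (1 : ℂ)
    · simpa using (hasDerivAt_id x).ofReal_comp
  · set k := Real.sqrt lam with hk
    have hk0 : 0 < k := Real.sqrt_pos.2 hpos
    have hkk : k * k = lam := Real.mul_self_sqrt hlam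
    have hkx : ∀ x : ℝ, HasDerivAt (fun x => k * x) k x := fun x => by
      simpa using (hasDerivAt_id x).const_mul k
    refine ⟨fun x => (Real.cos (k * x) : ℝ), fun x => (Real.sin (k * x) / k : ℝ),
      ⟨fun x => ?_, fun x => ?_, by simp, by simp⟩, by simp, ?_⟩
    · convert! (hkx x).cos.ofReal_comp using 1
      rw [← hkk]
      push_cast
      have : (k : ℂ) ≠ 0 := by exact_mod_cast hk0.ne'
      field_simp
    · convert! ((hkx x).sin.div_const k).ofReal_comp using 1
      rw [mul_div_assoc, div_self hk0.ne', mul_one]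
    · simp only [mul_one, ne_eq, Complex.ofReal_eq_zero, div_eq_zero_iff, hk0.ne', or_false]
      intro hs
      obtain ⟨n, hn⟩ := Real.sin_eq_zero_iff.1 hs
      have hn0 : 0 < n := by
        have : (0 : ℝ) < n := pos_of_mul_pos_left (hn ▸ hk0) Real.pi_pos.le
        exact_mod_cast this
      lift n to ℕ using hn0.le
      refine hlam' n (by exact_mod_cast hn0) ?_
      rw [← hkk, ← hn]
      push_cast
      ring

namespace FundamentalPair

variable {lam : ℂ} {C S : ℝ → ℂ}

theorem continuous_cos (P : FundamentalPair lam C S) : Continuous C :=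
  continuous_iff_continuousAt.2 fun x => (P.hasDerivAt_cos x).continuousAt

theorem continuous_sin (P : FundamentalPair lam C S) : Continuous S :=
  continuous_iff_continuousAt.2 fun x => (P.hasDerivAt_sin x).continuousAt

theorem isPrimitive_cos (P : FundamentalPair lam C S) : IsPrimitive C (fun x => -lam * S x) :=
  IsPrimitive.of_hasDerivAt P.hasDerivAt_cos (continuous_const.mul P.continuous_sin)

theorem isPrimitive_sin (P : FundamentalPair lam C S) : IsPrimitive S C :=
  IsPrimitive.of_hasDerivAt P.hasDerivAt_sin P.continuous_cos

/-- This is the Wronskian `C * S' - C' * S`, which is constant. It makes the fundamental matrix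
invertible at every point. -/
theorem sq_add_sq (P : FundamentalPair lam C S) (x : ℝ) : C x * C x + lam * (S x * S x) = 1 := by
  have hd : ∀ x, HasDerivAt (fun x => C x * C x + lam * (S x * S x)) 0 x := fun x => by
    have := ((P.hasDerivAt_cos x).mul (P.hasDerivAt_cos x)).add
      (((P.hasDerivAt_sin x).mul (P.hasDerivAt_sin x)).const_mul lam)
    convert! this using 1
    ring
  have := is_const_of_deriv_eq_zero (fun x => (hd x).differentiableAt) (fun x => (hd x).deriv) x 0
  rw [this, P.cos_zero, P.sin_zero]
  ring

theorem exists_bound (P : FundamentalPair lam C S) :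
    ∃ M : ℝ, 0 ≤ M ∧ ∀ x ∈ Set.Icc (0 : ℝ) 1, ‖C x‖ ≤ M ∧ ‖S x‖ ≤ M := by
  obtain ⟨A, hA⟩ := isCompact_Icc.exists_bound_of_continuousOn
    (P.continuous_cos.continuousOn (s := Set.Icc (0 : ℝ) 1))
  obtain ⟨B, hB⟩ := isCompact_Icc.exists_bound_of_continuousOn
    (P.continuous_sin.continuousOn (s := Set.Icc (0 : ℝ) 1))
  refine ⟨max A B, (norm_nonneg _).trans ((hA 0 ⟨le_rfl, zero_le_one⟩).trans (le_max_left _ _)),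
    fun x hx => ⟨(hA x hx).trans (le_max_left _ _), (hB x hx).trans (le_max_right _ _)⟩⟩

end FundamentalPair

/-! ### The inhomogeneous equation on an edge -/

/-- `u` is a continuously differentiable weak solution of `-u'' - lam * u = g` on `[0, L]`. -/
structure IsEdgeSolution (L : ℝ) (lam : ℂ) (g u : ℝ → ℂ) : Prop where
  contDiffOn : ContDiffOn ℝ 1 u (Set.Icc 0 L)
  secondDeriv : HasWeakSecondDeriv L u (fun x => -(lam * u x + g x))

/-- The contribution of the source term `g` to the derivative at the initial vertex. -/
noncomputable def initialSource (C S : ℝ → ℂ) (L : ℝ) (g : ℝ → ℂ) : ℂ :=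
  ∫ x in Set.Icc 0 L, (S 1 * C x - C 1 * S x) * g x

/-- The contribution of the source term `g` to the derivative at the terminal vertex. -/
noncomputable def terminalSource (S : ℝ → ℂ) (L : ℝ) (g : ℝ → ℂ) : ℂ :=
  ∫ x in Set.Icc 0 L, S x * g x

section Edge

variable {lam : ℂ} {C S : ℝ → ℂ} {g u v : ℝ → ℂ}

theorem mul_intervalIntegrable {φ : ℝ → ℂ} (hφ : Continuous φ)
    (hg : IntervalIntegrable g volume 0 1) :
    IntervalIntegrable (fun x => φ x * g x) volume 0 1 :=
  hg.continuousOn_mul hφ.continuousOn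

theorem initialSource_eq (P : FundamentalPair lam C S) (hg : IntervalIntegrable g volume 0 1) :
    initialSource C S 1 g =
      S 1 * (∫ x in (0 : ℝ)..1, C x * g x) - C 1 * ∫ x in (0 : ℝ)..1, S x * g x := by
  rw [initialSource, setIntegral_Icc_eq]
  simp only [sub_mul, mul_assoc]
  rw [intervalIntegral.integral_sub ((mul_intervalIntegrable P.continuous_cos hg).const_mul _)
    ((mul_intervalIntegrable P.continuous_sin hg).const_mul _),
    intervalIntegral.integral_const_mul, intervalIntegral.integral_const_mul]

theorem isEdgeSolution_of_isPrimitive (h₁ : IsPrimitive u v)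
    (h₂ : IsPrimitive v (fun x => -(lam * u x + g x))) : IsEdgeSolution 1 lam g u :=
  ⟨h₁.contDiffOn h₂.continuousOn, hasWeakSecondDeriv_of_isPrimitive h₁ h₂⟩

theorem IsEdgeSolution.isPrimitive_deriv (h : IsEdgeSolution 1 lam g u)
    (hg : MemLp g 2 (volume.restrict (Set.Icc (0 : ℝ) 1))) :
    IsPrimitive (derivWithin u (Set.Icc 0 1)) (fun x => -(lam * u x + g x)) :=
  isPrimitive_derivWithin h.contDiffOn
    (((memLp_of_continuousOn h.contDiffOn.continuousOn).const_mul lam).add hg).neg h.secondDeriv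

/-- Variation of constants. -/
theorem eq_of_isPrimitive (P : FundamentalPair lam C S)
    (h₁ : IsPrimitive u v) (h₂ : IsPrimitive v (fun x => -(lam * u x + g x)))
    {x : ℝ} (hx : x ∈ Set.Icc (0 : ℝ) 1) :
    u x = C x * (u 0 + ∫ t in (0 : ℝ)..x, S t * g t) +
        S x * (v 0 - ∫ t in (0 : ℝ)..x, C t * g t) ∧
      v x = -lam * S x * (u 0 + ∫ t in (0 : ℝ)..x, S t * g t) +
        C x * (v 0 - ∫ t in (0 : ℝ)..x, C t * g t) := by
  -- `u * C - v * S` and `lam * u * S + v * C` are the coordinates of `(u, v)` in the fundamental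
  -- system; they are constant when `g = 0`.
  have hp : IsPrimitive (fun x => u x * C x - v x * S x) (fun x => S x * g x) :=
    ((h₁.mul P.isPrimitive_cos).sub (h₂.mul P.isPrimitive_sin)).congr_deriv
      (Filter.Eventually.of_forall fun x _ => by ring)
  have hq : IsPrimitive (fun x => lam * (u x * S x) + v x * C x) (fun x => -1 * (C x * g x)) :=
    (((h₁.mul P.isPrimitive_sin).const_mul lam).add (h₂.mul P.isPrimitive_cos)).congr_deriv
      (Filter.Eventually.of_forall fun x _ => by ring)
  have ep := hp.eq_add_integral x hx
  have eq := hq.eq_add_integral x hx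
  have hw := P.sq_add_sq x
  rw [intervalIntegral.integral_const_mul] at eq
  simp only [P.cos_zero, P.sin_zero] at ep eq
  constructor
  · linear_combination C x * ep + S x * eq - u x * hw
  · linear_combination -lam * S x * ep + C x * eq - v x * hw

theorem mul_deriv_initial_of_isPrimitive (P : FundamentalPair lam C S)
    (hg : IntervalIntegrable g volume 0 1)
    (h₁ : IsPrimitive u v) (h₂ : IsPrimitive v (fun x => -(lam * u x + g x))) :
    S 1 * v 0 = u 1 - C 1 * u 0 + initialSource C S 1 g := by
  rw [initialSource_eq P hg]
  linear_combination -(eq_of_isPrimitive P h₁ h₂ ⟨zero_le_one, le_rfl⟩).1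

/-- Eliminating `v 0` from the formulas for `u 1` and `v 1` gives the mirror image of the relation
at `0`. The sign of `v 1` appears because the outward direction at `1` points toward `0`. -/
theorem mul_deriv_terminal_of_isPrimitive (P : FundamentalPair lam C S)
    (h₁ : IsPrimitive u v) (h₂ : IsPrimitive v (fun x => -(lam * u x + g x))) :
    S 1 * -v 1 = u 0 - C 1 * u 1 + terminalSource S 1 g := by
  rw [terminalSource, setIntegral_Icc_eq]
  obtain ⟨e1, e2⟩ := eq_of_isPrimitive P h₁ h₂ (x := 1) ⟨zero_le_one, le_rfl⟩
  linear_combination -S 1 * e2 + C 1 * e1 + (u 0 + ∫ t in (0 : ℝ)..1, S t * g t) * P.sq_add_sq 1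

theorem exists_isPrimitive (P : FundamentalPair lam C S) (hS : S 1 ≠ 0)
    (hg : IntervalIntegrable g volume 0 1) (a b : ℂ) :
    ∃ u v, IsPrimitive u v ∧ IsPrimitive v (fun x => -(lam * u x + g x)) ∧ u 0 = a ∧ u 1 = b := by
  -- The initial slope is forced by `mul_deriv_initial_of_isPrimitive`; only here is division by `S
  -- 1` needed.
  set d : ℂ := (b - C 1 * a + initialSource C S 1 g) / S 1 with hd
  have hA := IsPrimitive.of_integral (mul_intervalIntegrable P.continuous_sin hg) a
  have hB := IsPrimitive.of_integral ((mul_intervalIntegrable P.continuous_cos hg).const_mul (-1)) d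
  refine ⟨_, _, ((P.isPrimitive_cos.mul hA).add (P.isPrimitive_sin.mul hB)).congr_deriv
    (g' := fun x => (-lam * S x) * (a + ∫ t in (0 : ℝ)..x, S t * g t) +
      C x * (d + ∫ t in (0 : ℝ)..x, -1 * (C t * g t)))
    (Filter.Eventually.of_forall fun x _ => by ring),
    (((P.isPrimitive_sin.const_mul (-lam)).mul hA).add (P.isPrimitive_cos.mul hB)).congr_deriv
      (Filter.Eventually.of_forall fun x _ => ?_), ?_, ?_⟩
  · linear_combination (-g x) * P.sq_add_sq x
  · simp [P.cos_zero, P.sin_zero]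
  · have : S 1 * d = b - C 1 * a + initialSource C S 1 g := by rw [hd]; field_simp
    rw [initialSource_eq P hg] at this
    rw [intervalIntegral.integral_const_mul]
    linear_combination this

/-- Integrating the derivative of `ψ' * u - ψ * v` expresses boundary values of `u` through `u` and
`g` alone: the zeros of `ψ` at both ends remove `v`. -/
theorem green_of_isPrimitive {ψ ψ' ψ'' : ℝ → ℂ} (hψ : IsPrimitive ψ ψ')
    (hψ' : IsPrimitive ψ' ψ'') (h0 : ψ 0 = 0) (h1 : ψ 1 = 0)
    (h₁ : IsPrimitive u v) (h₂ : IsPrimitive v (fun x => -(lam * u x + g x))) :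
    ψ' 1 * u 1 - ψ' 0 * u 0 =
      ∫ x in (0 : ℝ)..1, ((ψ'' x + lam * ψ x) * u x + ψ x * g x) := by
  have := (((hψ'.mul h₁).sub (hψ.mul h₂)).congr_deriv
    (g' := fun x => (ψ'' x + lam * ψ x) * u x + ψ x * g x)
    (Filter.Eventually.of_forall fun x _ => by ring)).integral_eq
  rw [this, h0, h1]
  ring

/-! ### Estimates on an edge -/

theorem norm_integral_mul_le {φ : ℝ → ℂ} {M : ℝ} (hM : 0 ≤ M)
    (hφ : ∀ x ∈ Set.Icc (0 : ℝ) 1, ‖φ x‖ ≤ M) (hg : IntervalIntegrable g volume 0 1)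
    {x : ℝ} (hx : x ∈ Set.Icc (0 : ℝ) 1) :
    ‖∫ t in (0 : ℝ)..x, φ t * g t‖ ≤ M * ∫ t in Set.Icc (0 : ℝ) 1, ‖g t‖ := by
  have hgi : IntegrableOn (fun t => ‖g t‖) (Set.Icc 0 1) :=
    ((intervalIntegrable_iff_integrableOn_Icc_of_le zero_le_one).1 hg).norm
  have hsub : Set.Ioc 0 x ⊆ Set.Icc (0 : ℝ) 1 := fun t ht => ⟨ht.1.le, ht.2.trans hx.2⟩
  rw [intervalIntegral.integral_of_le hx.1, ← integral_const_mul]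
  refine (norm_integral_le_of_norm_le ((hgi.mono_set hsub).const_mul M) ?_).trans
    (setIntegral_mono_set (hgi.const_mul M)
      (Filter.Eventually.of_forall fun t => mul_nonneg hM (norm_nonneg _))
      (Filter.Eventually.of_forall hsub))
  filter_upwards [ae_restrict_mem measurableSet_Ioc] with t ht
  rw [norm_mul]
  exact mul_le_mul_of_nonneg_right (hφ t (hsub ht)) (norm_nonneg _)

theorem volume_restrict_unit_univ : (volume.restrict (Set.Icc (0 : ℝ) 1)) Set.univ = 1 := by
  simp

/-- The unit interval has total mass one, so the `L¹` norm is at most the `L²` norm. -/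
theorem integral_norm_le (hg : MemLp g 2 (volume.restrict (Set.Icc (0 : ℝ) 1))) :
    ∫ t in Set.Icc (0 : ℝ) 1, ‖g t‖ ≤ (eLpNorm g 2 (volume.restrict (Set.Icc (0 : ℝ) 1))).toReal := by
  have : IsProbabilityMeasure (volume.restrict (Set.Icc (0 : ℝ) 1)) := ⟨volume_restrict_unit_univ⟩
  rw [integral_norm_eq_lintegral_enorm hg.1, ← eLpNorm_one_eq_lintegral_enorm]
  exact ENNReal.toReal_mono hg.2.ne (eLpNorm_le_eLpNorm_of_exponent_le (by norm_num) hg.1)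

theorem exists_norm_source_le (P : FundamentalPair lam C S) :
    ∃ K : ℝ, 0 ≤ K ∧ ∀ g : ℝ → ℂ, IntervalIntegrable g volume 0 1 →
      ‖initialSource C S 1 g‖ ≤ K * (∫ t in Set.Icc (0 : ℝ) 1, ‖g t‖) ∧
      ‖terminalSource S 1 g‖ ≤ K * (∫ t in Set.Icc (0 : ℝ) 1, ‖g t‖) := by
  obtain ⟨M, hM, hCS⟩ := P.exists_bound
  have h1 : (1 : ℝ) ∈ Set.Icc (0 : ℝ) 1 := ⟨zero_le_one, le_rfl⟩
  refine ⟨max (M * M + M * M) M, le_max_of_le_right hM, fun g hg => ⟨?_, ?_⟩⟩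
  · rw [initialSource, setIntegral_Icc_eq]
    refine norm_integral_mul_le (le_max_of_le_right hM) (fun x hx => le_max_of_le_left ?_) hg h1
    refine (norm_sub_le _ _).trans ?_
    rw [norm_mul, norm_mul]
    exact add_le_add (mul_le_mul (hCS 1 h1).2 (hCS x hx).1 (norm_nonneg _) hM)
      (mul_le_mul (hCS 1 h1).1 (hCS x hx).2 (norm_nonneg _) hM)
  · rw [terminalSource, setIntegral_Icc_eq]
    exact norm_integral_mul_le (le_max_of_le_right hM)
      (fun x hx => (hCS x hx).2.trans (le_max_right _ _)) hg h1

theorem exists_norm_le_boundary (P : FundamentalPair lam C S) (hS : S 1 ≠ 0) :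
    ∃ K : ℝ, 0 ≤ K ∧ ∀ g u v : ℝ → ℂ, IntervalIntegrable g volume 0 1 → IsPrimitive u v →
      IsPrimitive v (fun x => -(lam * u x + g x)) → ∀ x ∈ Set.Icc (0 : ℝ) 1,
      ‖u x‖ ≤ K * (‖u 0‖ + ‖u 1‖ + ∫ t in Set.Icc (0 : ℝ) 1, ‖g t‖) := by
  obtain ⟨M, hM, hCS⟩ := P.exists_bound
  obtain ⟨N, hN, hG⟩ := exists_norm_source_le P
  have hone : (1 : ℝ) ∈ Set.Icc (0 : ℝ) 1 := ⟨zero_le_one, le_rfl⟩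
  set T := ‖S 1‖⁻¹ with hT
  have hT0 : 0 ≤ T := inv_nonneg.2 (norm_nonneg _)
  -- The summands are the coefficients of `‖u 0‖`, `‖u 1‖` and `n` obtained by inserting `hv` into
  -- `hu`.
  refine ⟨(M + M * T * M) + M * T + (M * M + M * M + M * T * N), by positivity,
    fun g u v hg h₁ h₂ x hx => ?_⟩
  set n := ∫ t in Set.Icc (0 : ℝ) 1, ‖g t‖ with hn
  have hn0 : 0 ≤ n := integral_nonneg fun _ => norm_nonneg _
  have hv : ‖v 0‖ ≤ T * (‖u 1‖ + M * ‖u 0‖ + N * n) := by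
    have e : v 0 = (S 1)⁻¹ * (u 1 - C 1 * u 0 + initialSource C S 1 g) := by
      rw [← mul_deriv_initial_of_isPrimitive P hg h₁ h₂, inv_mul_cancel_left₀ hS]
    rw [e, norm_mul, norm_inv]
    refine mul_le_mul_of_nonneg_left ((norm_add_le _ _).trans ?_) hT0
    refine add_le_add ((norm_sub_le _ _).trans (add_le_add le_rfl ?_)) (hG g hg).1
    rw [norm_mul]
    exact mul_le_mul_of_nonneg_right (hCS 1 hone).1 (norm_nonneg _)
  have hu : ‖u x‖ ≤ M * (‖u 0‖ + M * n) + M * (‖v 0‖ + M * n) := by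
    rw [(eq_of_isPrimitive P h₁ h₂ hx).1]
    refine (norm_add_le _ _).trans ?_
    rw [norm_mul, norm_mul]
    refine add_le_add (mul_le_mul (hCS x hx).1 ?_ (norm_nonneg _) hM)
      (mul_le_mul (hCS x hx).2 ?_ (norm_nonneg _) hM)
    · exact (norm_add_le _ _).trans (add_le_add le_rfl
        (norm_integral_mul_le hM (fun y hy => (hCS y hy).2) hg hx))
    · exact (norm_sub_le _ _).trans (add_le_add le_rfl
        (norm_integral_mul_le hM (fun y hy => (hCS y hy).1) hg hx))
  have hMv := mul_le_mul_of_nonneg_left hv hM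
  have key : ‖u x‖ ≤ (M + M * T * M) * ‖u 0‖ + M * T * ‖u 1‖ +
      (M * M + M * M + M * T * N) * n := by nlinarith
  have h0 := norm_nonneg (u 0)
  have h1 := norm_nonneg (u 1)
  refine key.trans ?_
  set A := M + M * T * M with hA
  set B := M * T with hB
  set D := M * M + M * M + B * N with hD
  have hA0 : 0 ≤ A := by positivity
  have hB0 : 0 ≤ B := by positivity
  have hD0 : 0 ≤ D := by positivity
  rw [mul_add, mul_add]
  gcongr <;> linarith

theorem hasDerivAt_poly (a b c x : ℝ) :
    HasDerivAt (fun x : ℝ => ((a * x + b * x ^ 2 + c * x ^ 3 : ℝ) : ℂ))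
      ((a + 2 * b * x + 3 * c * x ^ 2 : ℝ) : ℂ) x := by
  refine HasDerivAt.ofReal_comp ?_
  have := ((((hasDerivAt_id x).const_mul a).add (((hasDerivAt_id x).pow 2).const_mul b)).add
    (((hasDerivAt_id x).pow 3).const_mul c))
  convert! this using 1
  simp
  ring

theorem hasDerivAt_poly_deriv (a b c x : ℝ) :
    HasDerivAt (fun x : ℝ => ((a + 2 * b * x + 3 * c * x ^ 2 : ℝ) : ℂ))
      ((2 * b + 6 * c * x : ℝ) : ℂ) x := by
  refine HasDerivAt.ofReal_comp ?_
  have := ((((hasDerivAt_id x).const_mul (2 * b)).const_add a).add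
    (((hasDerivAt_id x).pow 2).const_mul (3 * c)))
  convert! this using 1
  simp
  ring

/-- There are functions which vanish at both ends of `[0, 1]`, with given derivatives there. -/
theorem exists_cubic (p q : ℝ) : ∃ ψ ψ' ψ'' : ℝ → ℂ, IsPrimitive ψ ψ' ∧ IsPrimitive ψ' ψ'' ∧
    Continuous ψ ∧ Continuous ψ'' ∧ ψ 0 = 0 ∧ ψ 1 = 0 ∧ ψ' 0 = p ∧ ψ' 1 = q := by
  -- Coefficients of the cubic `a x + b x² + c x³` with `a = p`, `a + b + c = 0` and `a + 2b + 3c =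
  -- q`.
  refine ⟨_, _, _, IsPrimitive.of_hasDerivAt (hasDerivAt_poly p (-2 * p - q) (p + q))
    (by fun_prop), IsPrimitive.of_hasDerivAt (hasDerivAt_poly_deriv p (-2 * p - q) (p + q))
    (by fun_prop), by fun_prop, by fun_prop, ?_, ?_, ?_, ?_⟩
  · simp
  · push_cast
    ring
  · simp
  · push_cast
    ring

/-- A trace estimate, valid for every `lam`: Green's formula is applied with a cubic whose end
slopes single out one boundary value of `u`. -/
theorem exists_norm_boundary_le (lam : ℂ) :
    ∃ K : ℝ, 0 ≤ K ∧ ∀ g u v : ℝ → ℂ, IntervalIntegrable g volume 0 1 → IsPrimitive u v →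
      IsPrimitive v (fun x => -(lam * u x + g x)) →
      ‖u 0‖ ≤ K * ((∫ t in Set.Icc (0 : ℝ) 1, ‖u t‖) + ∫ t in Set.Icc (0 : ℝ) 1, ‖g t‖) ∧
      ‖u 1‖ ≤ K * ((∫ t in Set.Icc (0 : ℝ) 1, ‖u t‖) + ∫ t in Set.Icc (0 : ℝ) 1, ‖g t‖) := by
  have hone : (1 : ℝ) ∈ Set.Icc (0 : ℝ) 1 := ⟨zero_le_one, le_rfl⟩
  have key : ∀ p q : ℝ, ∃ K : ℝ, 0 ≤ K ∧ ∀ g u v : ℝ → ℂ, IntervalIntegrable g volume 0 1 →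
      IsPrimitive u v → IsPrimitive v (fun x => -(lam * u x + g x)) →
      ‖q * u 1 - p * u 0‖ ≤
        K * ((∫ t in Set.Icc (0 : ℝ) 1, ‖u t‖) + ∫ t in Set.Icc (0 : ℝ) 1, ‖g t‖) := by
    intro p q
    obtain ⟨ψ, ψ', ψ'', hψ, hψ', hc, hc'', h0, h1, hp, hq⟩ := exists_cubic p q
    have hcl : Continuous fun x => ψ'' x + lam * ψ x := hc''.add (continuous_const.mul hc)
    obtain ⟨A, hA⟩ := isCompact_Icc.exists_bound_of_continuousOn
      (hcl.continuousOn (s := Set.Icc (0 : ℝ) 1))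
    obtain ⟨B, hB⟩ := isCompact_Icc.exists_bound_of_continuousOn
      (hc.continuousOn (s := Set.Icc (0 : ℝ) 1))
    have hA0 : 0 ≤ max A B := (norm_nonneg _).trans ((hA 1 hone).trans (le_max_left _ _))
    refine ⟨max A B, hA0, fun g u v hg h₁ h₂ => ?_⟩
    have hu : IntervalIntegrable u volume 0 1 :=
      h₁.continuousOn.intervalIntegrable_of_Icc zero_le_one
    rw [← hp, ← hq, green_of_isPrimitive hψ hψ' h0 h1 h₁ h₂,
      intervalIntegral.integral_add (mul_intervalIntegrable hcl hu) (mul_intervalIntegrable hc hg),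
      mul_add]
    exact (norm_add_le _ _).trans (add_le_add
      (norm_integral_mul_le hA0 (fun x hx => (hA x hx).trans (le_max_left _ _)) hu hone)
      (norm_integral_mul_le hA0 (fun x hx => (hB x hx).trans (le_max_right _ _)) hg hone))
  -- With these two choices, `q * u 1 - p * u 0` is `u 0` and `u 1` respectively.
  obtain ⟨A, hA0, hA⟩ := key (-1) 0
  obtain ⟨B, hB0, hB⟩ := key 0 1
  refine ⟨max A B, le_max_of_le_left hA0, fun g u v hg h₁ h₂ => ⟨?_, ?_⟩⟩
  · refine le_trans ?_ ((hA g u v hg h₁ h₂).trans ?_)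
    · simp
    · gcongr
      exact le_max_left _ _
  · refine le_trans ?_ ((hB g u v hg h₁ h₂).trans ?_)
    · simp
    · gcongr
      exact le_max_right _ _

end Edge

/-! ### Edge estimates in squared `L²` norms. -/

section EdgeL2

variable {lam : ℂ} {C S : ℝ → ℂ} {L : ℝ} {g u : ℝ → ℂ}

/-- The length is a variable `L` with `L = 1`, so that the result applies to `Γ.length e` without
rewriting inside the type of `g e`. -/
theorem IsEdgeSolution.mul_deriv_initial (P : FundamentalPair lam C S) (hL : L = 1)
    (hg : MemLp g 2 (volume.restrict (Set.Icc 0 L))) (h : IsEdgeSolution L lam g u) :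
    S 1 * derivWithin u (Set.Icc 0 L) 0 = u L - C 1 * u 0 + initialSource C S L g := by
  subst hL
  exact mul_deriv_initial_of_isPrimitive P (intervalIntegrable_of_memLp hg)
    (IsPrimitive.of_contDiffOn h.contDiffOn) (h.isPrimitive_deriv hg)

theorem IsEdgeSolution.mul_deriv_terminal (P : FundamentalPair lam C S) (hL : L = 1)
    (hg : MemLp g 2 (volume.restrict (Set.Icc 0 L))) (h : IsEdgeSolution L lam g u) :
    S 1 * -derivWithin u (Set.Icc 0 L) L = u 0 - C 1 * u L + terminalSource S L g := by
  subst hL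
  exact mul_deriv_terminal_of_isPrimitive P
    (IsPrimitive.of_contDiffOn h.contDiffOn) (h.isPrimitive_deriv hg)

theorem exists_isEdgeSolution (P : FundamentalPair lam C S) (hS : S 1 ≠ 0) (hL : L = 1)
    (hg : MemLp g 2 (volume.restrict (Set.Icc 0 L))) (a b : ℂ) :
    ∃ u, IsEdgeSolution L lam g u ∧ u 0 = a ∧ u L = b := by
  subst hL
  obtain ⟨u, v, h₁, h₂, h0, h1⟩ := exists_isPrimitive P hS (intervalIntegrable_of_memLp hg) a b
  exact ⟨u, isEdgeSolution_of_isPrimitive h₁ h₂, h0, h1⟩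

theorem ennreal_add_sq_le (a b : ℝ≥0∞) : (a + b) ^ 2 ≤ 2 * (a ^ 2 + b ^ 2) := by
  rcases eq_or_ne a ⊤ with rfl | ha
  · simp
  rcases eq_or_ne b ⊤ with rfl | hb
  · simp
  lift a to NNReal using ha
  lift b to NNReal using hb
  exact_mod_cast add_sq_le (a := a) (b := b)

theorem ennreal_add_three_sq_le (a b c : ℝ≥0∞) :
    (a + b + c) ^ 2 ≤ 4 * (a ^ 2 + b ^ 2 + c ^ 2) := by
  calc (a + b + c) ^ 2 ≤ 2 * ((a + b) ^ 2 + c ^ 2) := ennreal_add_sq_le _ _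
    _ ≤ 2 * (2 * (a ^ 2 + b ^ 2) + 2 * c ^ 2) := by
        gcongr
        · exact ennreal_add_sq_le a b
        · exact le_mul_of_one_le_left zero_le (by norm_num)
    _ = 4 * (a ^ 2 + b ^ 2 + c ^ 2) := by ring

/-- The pointwise bound on an interval of mass one is also an `L²` bound. The squared form in `ℝ≥0∞`
can be summed over the edges with no summability conditions. -/
theorem exists_eLpNorm_le_boundary (P : FundamentalPair lam C S) (hS : S 1 ≠ 0) :
    ∃ K : ℝ≥0∞, K ≠ ⊤ ∧ ∀ {L : ℝ} {g u : ℝ → ℂ}, L = 1 →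
      MemLp g 2 (volume.restrict (Set.Icc 0 L)) → IsEdgeSolution L lam g u →
      eLpNorm u 2 (volume.restrict (Set.Icc 0 L)) ^ 2 ≤
        K * (‖u 0‖ₑ ^ 2 + ‖u L‖ₑ ^ 2 + eLpNorm g 2 (volume.restrict (Set.Icc 0 L)) ^ 2) := by
  obtain ⟨K, hK, h⟩ := exists_norm_le_boundary P hS
  refine ⟨ENNReal.ofReal K ^ 2 * 4, by finiteness, fun {L g u} hL hg hu => ?_⟩
  subst hL
  have hb : eLpNorm u 2 (volume.restrict (Set.Icc (0 : ℝ) 1)) ≤ ENNReal.ofReal K *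
      (‖u 0‖ₑ + ‖u 1‖ₑ + eLpNorm g 2 (volume.restrict (Set.Icc (0 : ℝ) 1))) := by
    have e : ENNReal.ofReal K *
        (‖u 0‖ₑ + ‖u 1‖ₑ + eLpNorm g 2 (volume.restrict (Set.Icc (0 : ℝ) 1))) =
        ENNReal.ofReal (K * (‖u 0‖ + ‖u 1‖ +
          (eLpNorm g 2 (volume.restrict (Set.Icc (0 : ℝ) 1))).toReal)) := by
      rw [ENNReal.ofReal_mul hK, ENNReal.ofReal_add (by positivity) ENNReal.toReal_nonneg,
        ENNReal.ofReal_add (norm_nonneg _) (norm_nonneg _), ENNReal.ofReal_toReal hg.2.ne,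
        ofReal_norm, ofReal_norm]
    rw [e]
    refine (eLpNorm_le_of_ae_bound (C := K * (‖u 0‖ + ‖u 1‖ +
          (eLpNorm g 2 (volume.restrict (Set.Icc (0 : ℝ) 1))).toReal)) ?_).trans ?_
    · filter_upwards [ae_restrict_mem measurableSet_Icc] with x hx
      refine (h g u _ (intervalIntegrable_of_memLp hg) (IsPrimitive.of_contDiffOn hu.contDiffOn)
        (hu.isPrimitive_deriv hg) x hx).trans ?_
      gcongr
      exact integral_norm_le hg
    · rw [volume_restrict_unit_univ]
      simp
  calc _ ≤ (ENNReal.ofReal K *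
      (‖u 0‖ₑ + ‖u 1‖ₑ + eLpNorm g 2 (volume.restrict (Set.Icc (0 : ℝ) 1)))) ^ 2 := by gcongr
    _ ≤ _ := by
      rw [mul_pow, mul_assoc]
      gcongr
      exact ennreal_add_three_sq_le _ _ _

theorem exists_boundary_le_eLpNorm (lam : ℂ) :
    ∃ K : ℝ≥0∞, K ≠ ⊤ ∧ ∀ {L : ℝ} {g u : ℝ → ℂ}, L = 1 →
      MemLp g 2 (volume.restrict (Set.Icc 0 L)) → IsEdgeSolution L lam g u →
      ‖u 0‖ₑ ^ 2 + ‖u L‖ₑ ^ 2 ≤ K * (eLpNorm u 2 (volume.restrict (Set.Icc 0 L)) ^ 2 +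
        eLpNorm g 2 (volume.restrict (Set.Icc 0 L)) ^ 2) := by
  obtain ⟨K, hK, h⟩ := exists_norm_boundary_le lam
  refine ⟨2 * (ENNReal.ofReal K ^ 2 * 2), by finiteness, fun {L g u} hL hg hu => ?_⟩
  subst hL
  have hum := memLp_of_continuousOn hu.contDiffOn.continuousOn
  have key : ∀ z : ℂ, ‖z‖ ≤ K * ((∫ t in Set.Icc (0 : ℝ) 1, ‖u t‖) +
      ∫ t in Set.Icc (0 : ℝ) 1, ‖g t‖) → ‖z‖ₑ ^ 2 ≤ (ENNReal.ofReal K ^ 2 * 2) *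
      (eLpNorm u 2 (volume.restrict (Set.Icc 0 1)) ^ 2 +
        eLpNorm g 2 (volume.restrict (Set.Icc 0 1)) ^ 2) := by
    intro z hz
    have hb : ‖z‖ₑ ≤ ENNReal.ofReal K * (eLpNorm u 2 (volume.restrict (Set.Icc (0 : ℝ) 1)) +
        eLpNorm g 2 (volume.restrict (Set.Icc (0 : ℝ) 1))) := by
      rw [← ofReal_norm, ← ENNReal.ofReal_toReal hum.2.ne, ← ENNReal.ofReal_toReal hg.2.ne,
        ← ENNReal.ofReal_add ENNReal.toReal_nonneg ENNReal.toReal_nonneg, ← ENNReal.ofReal_mul hK]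
      refine ENNReal.ofReal_le_ofReal (hz.trans ?_)
      gcongr
      · exact integral_norm_le hum
      · exact integral_norm_le hg
    calc ‖z‖ₑ ^ 2 ≤ (ENNReal.ofReal K * (eLpNorm u 2 (volume.restrict (Set.Icc (0 : ℝ) 1)) +
        eLpNorm g 2 (volume.restrict (Set.Icc (0 : ℝ) 1)))) ^ 2 := by gcongr
      _ ≤ _ := by
        rw [mul_pow, mul_assoc]
        gcongr
        exact ennreal_add_sq_le _ _
  obtain ⟨h0, h1⟩ := h g u _ (intervalIntegrable_of_memLp hg)
    (IsPrimitive.of_contDiffOn hu.contDiffOn) (hu.isPrimitive_deriv hg)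
  rw [mul_assoc, two_mul]
  exact add_le_add (key _ h0) (key _ h1)

theorem exists_source_le_eLpNorm (P : FundamentalPair lam C S) :
    ∃ K : ℝ≥0∞, K ≠ ⊤ ∧ ∀ {L : ℝ} {g : ℝ → ℂ}, L = 1 →
      MemLp g 2 (volume.restrict (Set.Icc 0 L)) →
      ‖initialSource C S L g‖ₑ ^ 2 ≤ K * eLpNorm g 2 (volume.restrict (Set.Icc 0 L)) ^ 2 ∧
      ‖terminalSource S L g‖ₑ ^ 2 ≤ K * eLpNorm g 2 (volume.restrict (Set.Icc 0 L)) ^ 2 := by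
  obtain ⟨K, hK, h⟩ := exists_norm_source_le P
  refine ⟨ENNReal.ofReal K ^ 2, by finiteness, fun {L g} hL hg => ?_⟩
  subst hL
  have key : ∀ z : ℂ, ‖z‖ ≤ K * (∫ t in Set.Icc (0 : ℝ) 1, ‖g t‖) →
      ‖z‖ₑ ^ 2 ≤ ENNReal.ofReal K ^ 2 *
        eLpNorm g 2 (volume.restrict (Set.Icc (0 : ℝ) 1)) ^ 2 := by
    intro z hz
    rw [← mul_pow]
    gcongr
    rw [← ofReal_norm, ← ENNReal.ofReal_toReal hg.2.ne, ← ENNReal.ofReal_mul hK]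
    refine ENNReal.ofReal_le_ofReal (hz.trans ?_)
    gcongr
    exact integral_norm_le hg
  exact ⟨key _ (h g (intervalIntegrable_of_memLp hg)).1,
    key _ (h g (intervalIntegrable_of_memLp hg)).2⟩

/-- There are source terms with prescribed contributions to the derivatives at the vertices. -/
theorem exists_source_eq (P : FundamentalPair lam C S) (p q : ℝ) :
    ∃ φ : ℝ → ℂ, Continuous φ ∧ initialSource C S 1 φ = S 1 * p ∧
      terminalSource S 1 φ = S 1 * q := by
  -- The source is the one whose solution is the cubic `ψ`: its boundary values vanish, so only its
  -- outward derivatives `p` and `q` remain. The outward derivative at `1` is `-ψ' 1`, hence `-q`.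
  obtain ⟨ψ, ψ', ψ'', hψ, hψ', hc, hc'', h0, h1, hp, hq⟩ := exists_cubic p (-q)
  have hcont : Continuous fun x => -(lam * ψ x + ψ'' x) :=
    ((continuous_const.mul hc).add hc'').neg
  have hd : IsPrimitive ψ' (fun x => -(lam * ψ x + -(lam * ψ x + ψ'' x))) :=
    hψ'.congr_deriv (Filter.Eventually.of_forall fun x _ => by ring)
  refine ⟨_, hcont, ?_, ?_⟩
  · have := mul_deriv_initial_of_isPrimitive P (hcont.intervalIntegrable _ _) hψ hd
    rw [h0, h1, hp] at this
    rw [this]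
    ring
  · have := mul_deriv_terminal_of_isPrimitive P hψ hd
    rw [h0, h1, hq] at this
    push_cast at this
    rw [neg_neg] at this
    rw [this]
    ring

theorem initialSource_congr {g₁ g₂ : ℝ → ℂ} (h : g₁ =ᵐ[volume.restrict (Set.Icc 0 L)] g₂) :
    initialSource C S L g₁ = initialSource C S L g₂ :=
  integral_congr_ae (h.mono fun x hx => by simp only [hx])

theorem terminalSource_congr {g₁ g₂ : ℝ → ℂ} (h : g₁ =ᵐ[volume.restrict (Set.Icc 0 L)] g₂) :
    terminalSource S L g₁ = terminalSource S L g₂ :=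
  integral_congr_ae (h.mono fun x hx => by simp only [hx])

theorem integral_mul_combination {φ φ₀ φ₁ : ℝ → ℂ} (hφ : Continuous φ) (h₀ : Continuous φ₀)
    (h₁ : Continuous φ₁) (a b : ℂ) :
    ∫ x in Set.Icc (0 : ℝ) 1, φ x * (a * φ₀ x + b * φ₁ x) =
      a * (∫ x in Set.Icc (0 : ℝ) 1, φ x * φ₀ x) + b * ∫ x in Set.Icc (0 : ℝ) 1, φ x * φ₁ x := by
  rw [← integral_const_mul, ← integral_const_mul, ← integral_add]
  · exact integral_congr_ae (Filter.Eventually.of_forall fun x => by ring)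
  · exact (continuous_const.mul (hφ.mul h₀)).continuousOn.integrableOn_compact isCompact_Icc
  · exact (continuous_const.mul (hφ.mul h₁)).continuousOn.integrableOn_compact isCompact_Icc

/-- Linear combinations of two fixed profiles suffice, so one constant serves for all `a` and `b`,
and thus for all edges. -/
theorem exists_source_lp (P : FundamentalPair lam C S) :
    ∃ K : ℝ≥0∞, K ≠ ⊤ ∧ ∀ {L : ℝ}, L = 1 → ∀ a b : ℂ,
      ∃ γ : Lp ℂ 2 (volume.restrict (Set.Icc 0 L)), initialSource C S L γ = S 1 * a ∧
        terminalSource S L γ = S 1 * b ∧ ‖γ‖ₑ ^ 2 ≤ K * (‖a‖ₑ ^ 2 + ‖b‖ₑ ^ 2) := by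
  obtain ⟨φ₀, hc₀, hi₀, ht₀⟩ := exists_source_eq P 1 0
  obtain ⟨φ₁, hc₁, hi₁, ht₁⟩ := exists_source_eq P 0 1
  have hm₀ := memLp_of_continuousOn hc₀.continuousOn
  have hm₁ := memLp_of_continuousOn hc₁.continuousOn
  set N₀ := eLpNorm φ₀ 2 (volume.restrict (Set.Icc (0 : ℝ) 1)) with hN₀
  set N₁ := eLpNorm φ₁ 2 (volume.restrict (Set.Icc (0 : ℝ) 1)) with hN₁
  have hf₀ : N₀ ≠ ⊤ := hm₀.2.ne
  have hf₁ : N₁ ≠ ⊤ := hm₁.2.ne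
  refine ⟨(N₀ + N₁) ^ 2 * 2, by finiteness, fun {L} hL a b => ?_⟩
  subst hL
  have hm : MemLp (fun x => a * φ₀ x + b * φ₁ x) 2 (volume.restrict (Set.Icc (0 : ℝ) 1)) :=
    (hm₀.const_mul a).add (hm₁.const_mul b)
  refine ⟨hm.toLp, ?_, ?_, ?_⟩
  · have hc : Continuous fun x => S 1 * C x - C 1 * S x :=
      (continuous_const.mul P.continuous_cos).sub (continuous_const.mul P.continuous_sin)
    rw [initialSource_congr hm.coeFn_toLp, initialSource, integral_mul_combination hc hc₀ hc₁]
    rw [initialSource] at hi₀ hi₁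
    rw [hi₀, hi₁]
    simp [mul_comm]
  · rw [terminalSource_congr hm.coeFn_toLp, terminalSource,
      integral_mul_combination P.continuous_sin hc₀ hc₁]
    rw [terminalSource] at ht₀ ht₁
    rw [ht₀, ht₁]
    simp [mul_comm]
  · rw [Lp.enorm_def, eLpNorm_congr_ae hm.coeFn_toLp]
    have hle : eLpNorm (fun x => a * φ₀ x + b * φ₁ x) 2 (volume.restrict (Set.Icc (0 : ℝ) 1)) ≤
        (N₀ + N₁) * (‖a‖ₑ + ‖b‖ₑ) := by
      refine (eLpNorm_add_le (hm₀.const_mul a).1 (hm₁.const_mul b).1 (by norm_num)).trans ?_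
      change eLpNorm (a • φ₀) _ _ + eLpNorm (b • φ₁) _ _ ≤ _
      rw [eLpNorm_const_smul, eLpNorm_const_smul, ← hN₀, ← hN₁, mul_add, add_mul, add_mul,
        mul_comm ‖a‖ₑ, mul_comm ‖b‖ₑ]
      exact add_le_add le_self_add le_add_self
    calc _ ≤ ((N₀ + N₁) * (‖a‖ₑ + ‖b‖ₑ)) ^ 2 := by gcongr
      _ ≤ _ := by
        rw [mul_pow, mul_assoc]
        gcongr
        exact ennreal_add_sq_le _ _

end EdgeL2

/-! ### Resolvents and the square norms of the two Hilbert spaces -/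

/-- The lower bound gives injectivity and bounds the algebraic inverse by `√K`; closedness of `A` is
not required. -/
theorem mem_opResolventSet_of_bound {H : Type*} [NormedAddCommGroup H] [InnerProductSpace ℂ H]
    {A : H →ₗ.[ℂ] H} {z : ℂ} (hsurj : ∀ y : H, ∃ x : A.domain, A x - z • (x : H) = y)
    {K : ℝ≥0∞} (hK : K ≠ ⊤)
    (hb : ∀ x : A.domain, ‖(x : H)‖ₑ ^ 2 ≤ K * ‖A x - z • (x : H)‖ₑ ^ 2) :
    z ∈ opResolventSet A := by
  have hb' : ∀ x : A.domain, ‖(x : H)‖ ≤ Real.sqrt K.toReal * ‖A x - z • (x : H)‖ := fun x => by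
    have h := ENNReal.toReal_mono (by finiteness) (hb x)
    rw [ENNReal.toReal_mul, ENNReal.toReal_pow, ENNReal.toReal_pow, toReal_enorm,
      toReal_enorm] at h
    rw [← Real.sqrt_sq (norm_nonneg (x : H)), ← Real.sqrt_sq (norm_nonneg (A x - z • (x : H))),
      ← Real.sqrt_mul ENNReal.toReal_nonneg]
    exact Real.sqrt_le_sqrt h
  let T : A.domain →ₗ[ℂ] H := A.toFun - z • A.domain.subtype
  have hT : ∀ x, T x = A x - z • (x : H) := fun x => rfl
  have hinj : Function.Injective T := by
    rw [injective_iff_map_eq_zero]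
    intro x hx
    have := hb' x
    rw [← hT, hx, norm_zero, mul_zero] at this
    exact Subtype.ext (norm_le_zero_iff.1 this)
  let E := LinearEquiv.ofBijective T ⟨hinj, hsurj⟩
  have hE : ∀ y, T (E.symm y) = y := fun y => E.apply_symm_apply y
  refine ⟨(A.domain.subtype ∘ₗ E.symm.toLinearMap).mkContinuous (Real.sqrt K.toReal) fun y => ?_,
    fun y => ⟨E.symm y, rfl, hE y⟩, fun x => ?_⟩
  · have := hb' (E.symm y)
    rwa [← hT, hE] at this
  · exact congrArg Subtype.val (E.symm_apply_apply x)

theorem tsum_enorm_sq_eq {ι : Type*} {E : ι → Type*} [∀ i, NormedAddCommGroup (E i)]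
    (f : lp E 2) : ∑' i, ‖f i‖ₑ ^ 2 = ‖f‖ₑ ^ 2 := by
  have h2 : (0 : ℝ) < (2 : ℝ≥0∞).toReal := by norm_num
  have hs := (lp.memℓp f).summable h2
  have hn := lp.norm_rpow_eq_tsum h2 f
  simp only [ENNReal.toReal_ofNat, Real.rpow_ofNat] at hs hn
  rw [← ofReal_norm, ← ENNReal.ofReal_pow (norm_nonneg _), hn,
    ENNReal.ofReal_tsum_of_nonneg (fun _ => sq_nonneg _) hs]
  refine tsum_congr fun i => ?_
  rw [ENNReal.ofReal_pow (norm_nonneg _), ofReal_norm]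

theorem memℓp_of_tsum_enorm_sq {ι : Type*} {E : ι → Type*} [∀ i, NormedAddCommGroup (E i)]
    {f : ∀ i, E i} (h : ∑' i, ‖f i‖ₑ ^ 2 ≠ ⊤) : Memℓp f 2 := by
  refine memℓp_gen ?_
  have := ENNReal.summable_toReal h
  simpa using this

/-! ### The space `ℓ²(V; deg)` in terms of vertex values. -/

section Vertex

variable {V : Type*} {G : SimpleGraph V} [G.LocallyFinite] [MeasurableSpace V]
  [DiscreteMeasurableSpace V]

theorem eLpNorm_degMeasure_sq (f : V → ℂ) : eLpNorm f 2 (degMeasure G) ^ 2 =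
    ∑' v : V, (G.degree v : ℝ≥0∞) * ‖f v‖ₑ ^ 2 := by
  rw [eLpNorm_eq_lintegral_rpow_enorm_toReal (by norm_num) (by norm_num), lintegral_degMeasure,
    ← ENNReal.rpow_natCast, ← ENNReal.rpow_mul]
  simp

theorem enorm_vertexL2_sq (f : VertexL2 G) : ‖f‖ₑ ^ 2 =
    ∑' v : V, (G.degree v : ℝ≥0∞) * ‖f v‖ₑ ^ 2 := by
  rw [Lp.enorm_def, eLpNorm_degMeasure_sq]

/-- Without isolated vertices each vertex has positive mass, so equality almost everywhere is
equality at every vertex. -/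
theorem exists_vertexL2_eq (hdeg : ∀ v, G.degree v ≠ 0) {f : V → ℂ}
    (hf : ∑' v : V, (G.degree v : ℝ≥0∞) * ‖f v‖ₑ ^ 2 ≠ ⊤) :
    ∃ F : VertexL2 G, ∀ v, F v = f v := by
  have hm : MemLp f 2 (degMeasure G) := by
    refine ⟨(Measurable.of_discrete).aestronglyMeasurable, lt_top_iff_ne_top.2 fun h => hf ?_⟩
    rw [← eLpNorm_degMeasure_sq, h]
    simp
  exact ⟨hm.toLp, fun v => (ae_degMeasure G).1 hm.coeFn_toLp v (hdeg v)⟩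

theorem normalizedLaplacian_sub_smul_apply (hdeg : ∀ v, G.degree v ≠ 0) (F : VertexL2 G) (z : ℂ)
    (v : V) : (normalizedLaplacian G F - z • F : VertexL2 G) v = normLap G F v - z * F v := by
  have h1 := (ae_degMeasure G).1 (Lp.coeFn_sub (normalizedLaplacian G F) (z • F)) v (hdeg v)
  have h2 := (ae_degMeasure G).1 (Lp.coeFn_smul z F) v (hdeg v)
  have h3 := (ae_degMeasure G).1 (normalizedLaplacian_ae G F) v (hdeg v)
  rw [h1, Pi.sub_apply, h2, h3, Pi.smul_apply, smul_eq_mul]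

end Vertex

/-- Cauchy-Schwarz costs one factor `s.card`, which with the weight cancels the square of `1 /
s.card`. -/
theorem degree_mul_enorm_average_sq_le {ι : Type*} (s : Finset ι) (z : ι → ℂ) :
    (s.card : ℝ≥0∞) * ‖(1 / (s.card : ℂ)) * ∑ i ∈ s, z i‖ₑ ^ 2 ≤ ∑ i ∈ s, ‖z i‖ₑ ^ 2 := by
  have e : ∀ w : ℂ, ‖w‖ₑ ^ 2 = ENNReal.ofReal (‖w‖ ^ 2) := fun w => by
    rw [ENNReal.ofReal_pow (norm_nonneg _), ofReal_norm]
  have hcard : (s.card : ℝ≥0∞) = ENNReal.ofReal (s.card : ℝ) := by simp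
  simp only [e, hcard]
  rw [← ENNReal.ofReal_sum_of_nonneg fun _ _ => sq_nonneg _, ← ENNReal.ofReal_mul (by positivity)]
  refine ENNReal.ofReal_le_ofReal ?_
  rcases s.eq_empty_or_nonempty with rfl | hs
  · simp
  have hpos : (0 : ℝ) < s.card := by exact_mod_cast hs.card_pos
  have h1 : ‖∑ i ∈ s, z i‖ ^ 2 ≤ (s.card : ℝ) * ∑ i ∈ s, ‖z i‖ ^ 2 :=
    (pow_le_pow_left₀ (norm_nonneg _) (norm_sum_le _ _) 2).trans sq_sum_le_card_mul_sum_sq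
  rw [norm_mul, norm_div, norm_one, Complex.norm_natCast, mul_pow]
  calc (s.card : ℝ) * ((1 / (s.card : ℝ)) ^ 2 * ‖∑ i ∈ s, z i‖ ^ 2)
      = (1 / (s.card : ℝ)) * ‖∑ i ∈ s, z i‖ ^ 2 := by field_simp
    _ ≤ (1 / (s.card : ℝ)) * ((s.card : ℝ) * ∑ i ∈ s, ‖z i‖ ^ 2) := by gcongr
    _ = _ := by field_simp

/-! ### Reduction to the vertices -/

namespace MetricGraph

variable {V : Type*} {G : SimpleGraph V} (Γ : MetricGraph G)

theorem dartEdge_orient (e : G.edgeSet) : dartEdge (Γ.orient e) = e :=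
  Subtype.ext (Γ.edge_orient e)

theorem dartEdge_symm (d : G.Dart) : dartEdge d.symm = dartEdge d :=
  Subtype.ext d.edge_symm

theorem orient_dartEdge (d : G.Dart) :
    Γ.orient (dartEdge d) = d ∨ Γ.orient (dartEdge d) = d.symm :=
  SimpleGraph.dart_edge_eq_iff _ _ |>.1 (Γ.edge_orient (dartEdge d))

/-- Darts are counted in two ways: two for each edge, and one for each neighbor of each vertex. -/
theorem tsum_edge_eq_tsum_vertex [G.LocallyFinite] (F : G.Dart → ℝ≥0∞) :
    ∑' e : G.edgeSet, (F (Γ.orient e) + F (Γ.orient e).symm) =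
      ∑' v : V, ∑ w : G.neighborSet v, F (G.dartOfNeighborSet v w) := by
  let φ : G.edgeSet × Bool → G.Dart := fun p => if p.2 then Γ.orient p.1 else (Γ.orient p.1).symm
  have hφe : ∀ p, dartEdge (φ p) = p.1 := by
    rintro ⟨e, b⟩
    cases b
    · exact (dartEdge_symm _).trans (Γ.dartEdge_orient e)
    · exact Γ.dartEdge_orient e
  have hφ : Function.Bijective φ := by
    constructor
    · rintro ⟨e, b⟩ ⟨e', b'⟩ h
      obtain rfl : e = e' := (hφe (e, b)).symm.trans ((congrArg dartEdge h).trans (hφe (e', b')))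
      have hne := (Γ.orient e).symm_ne
      cases b <;> cases b'
      · rfl
      · exact absurd h hne
      · exact absurd h.symm hne
      · rfl
    · intro d
      rcases Γ.orient_dartEdge d with h | h
      · exact ⟨(dartEdge d, true), h⟩
      · refine ⟨(dartEdge d, false), ?_⟩
        change (Γ.orient (dartEdge d)).symm = d
        rw [h, SimpleGraph.Dart.symm_symm]
  let ψ : G.Dart ≃ Σ v : V, G.neighborSet v :=
    { toFun := fun d => ⟨d.fst, d.snd, d.adj⟩
      invFun := fun p => G.dartOfNeighborSet p.1 p.2
      left_inv := fun d => rfl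
      right_inv := fun p => rfl }
  calc ∑' e : G.edgeSet, (F (Γ.orient e) + F (Γ.orient e).symm)
      = ∑' e : G.edgeSet, ∑' b : Bool, F (φ (e, b)) :=
        tsum_congr fun e => by rw [tsum_bool, add_comm]; rfl
    _ = ∑' p : G.edgeSet × Bool, F (φ p) := (ENNReal.tsum_prod (f := fun e b => F (φ (e, b)))).symm
    _ = ∑' d, F d := (Equiv.ofBijective φ hφ).tsum_eq F
    _ = ∑' p, F (ψ.symm p) := (ψ.symm.tsum_eq F).symm
    _ = ∑' v : V, ∑' w : G.neighborSet v, F (G.dartOfNeighborSet v w) := ENNReal.tsum_sigma' _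
    _ = _ := tsum_congr fun v => tsum_fintype _

open Classical in
/-- The contribution of the source term `g` to the derivative along the dart `d`. -/
noncomputable def dartSource (C S : ℝ → ℂ) (g : Γ.L2) (d : G.Dart) : ℂ :=
  if Γ.orient (dartEdge d) = d then
    initialSource C S (Γ.length (dartEdge d)) (g (dartEdge d))
  else
    terminalSource S (Γ.length (dartEdge d)) (g (dartEdge d))

/-- The average over the neighbors of a vertex of the contributions of `g` to the derivatives. -/
noncomputable def vertexSource [G.LocallyFinite] (C S : ℝ → ℂ) (g : Γ.L2) (v : V) : ℂ :=
  (1 / (G.degree v : ℂ)) * ∑ w : G.neighborSet v, Γ.dartSource C S g (G.dartOfNeighborSet v w)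

/-- `u` solves `-u'' - lam * u = g` on all edges, and has the vertex values `a`. -/
structure IsEdgewiseSolution (lam : ℂ) (g : Γ.L2) (u : G.edgeSet → ℝ → ℂ) (a : V → ℂ) : Prop where
  isEdgeSolution : ∀ e, IsEdgeSolution (Γ.length e) lam (g e) (u e)
  initial : ∀ e, u e 0 = a (Γ.orient e).fst
  terminal : ∀ e, u e (Γ.length e) = a (Γ.orient e).snd

section

variable {lam : ℂ} {C S : ℝ → ℂ} {Γ} {g : Γ.L2} {u : G.edgeSet → ℝ → ℂ} {a : V → ℂ}

/-- The relations at the two ends of an edge are mirror images, so in terms of darts the chosen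
orientation survives only inside `dartSource`. -/
theorem IsEdgewiseSolution.mul_outwardDeriv (h : Γ.IsEdgewiseSolution lam g u a)
    (hΓ : Γ.IsEquilateral) (P : FundamentalPair lam C S) (d : G.Dart) :
    S 1 * Γ.outwardDeriv u d = a d.snd - C 1 * a d.fst + Γ.dartSource C S g d := by
  have hi := (h.isEdgeSolution (dartEdge d)).mul_deriv_initial P (hΓ _) (Lp.memLp _)
  have ht := (h.isEdgeSolution (dartEdge d)).mul_deriv_terminal P (hΓ _) (Lp.memLp _)
  rw [h.initial, h.terminal] at hi ht
  unfold outwardDeriv dartSource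
  split_ifs with hd
  · rw [hi, hd]
  · rw [ht, (Γ.orient_dartEdge d).resolve_left hd]
    rfl

/-- Summing `mul_outwardDeriv` over the neighbors produces `∑ a w - deg v * C 1 * a v`, which is
`-deg v` times the left side of the vertex equation. The factor `S 1` can be cancelled. -/
theorem IsEdgewiseSolution.kirchhoff_iff [G.LocallyFinite] (h : Γ.IsEdgewiseSolution lam g u a)
    (hΓ : Γ.IsEquilateral) (P : FundamentalPair lam C S) (hS : S 1 ≠ 0) {v : V}
    (hv : G.degree v ≠ 0) :
    ∑ w : G.neighborSet v, Γ.outwardDeriv u (G.dartOfNeighborSet v w) = 0 ↔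
      normLap G a v - (1 - C 1) * a v = Γ.vertexSource C S g v := by
  have hv' : (G.degree v : ℂ) ≠ 0 := by exact_mod_cast hv
  have hsum : ∑ w : G.neighborSet v, a w = ∑ w ∈ G.neighborFinset v, a w :=
    (Finset.sum_subtype (G.neighborFinset v) (fun x => by simp) a).symm
  have key : S 1 * ∑ w : G.neighborSet v, Γ.outwardDeriv u (G.dartOfNeighborSet v w) =
      (G.degree v : ℂ) * (Γ.vertexSource C S g v - (normLap G a v - (1 - C 1) * a v)) := by
    rw [Finset.mul_sum, Finset.sum_congr rfl fun w _ => h.mul_outwardDeriv hΓ P _,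
      Finset.sum_add_distrib, Finset.sum_sub_distrib]
    change ∑ w : G.neighborSet v, a w - ∑ w : G.neighborSet v, C 1 * a v + _ = _
    rw [hsum, Finset.sum_const, Finset.card_univ, SimpleGraph.card_neighborSet_eq_degree,
      vertexSource, normLap, Finset.sum_sub_distrib, Finset.sum_const,
      SimpleGraph.card_neighborFinset_eq_degree, nsmul_eq_mul, nsmul_eq_mul]
    field_simp
    ring
  constructor
  · intro h0
    rw [h0, mul_zero, eq_comm, mul_eq_zero, or_iff_right hv', sub_eq_zero] at key
    exact key.symm
  · intro h0
    rw [h0, sub_self, mul_zero, mul_eq_zero, or_iff_right hS] at key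
    exact key

theorem IsEdgewiseSolution.isKirchhoffRep [G.LocallyFinite] (h : Γ.IsEdgewiseSolution lam g u a)
    (hΓ : Γ.IsEquilateral) (P : FundamentalPair lam C S) (hS : S 1 ≠ 0)
    (hdeg : ∀ v, G.degree v ≠ 0)
    (heq : ∀ v, normLap G a v - (1 - C 1) * a v = Γ.vertexSource C S g v)
    {f : Γ.L2} (hf : ∀ e, (f e : ℝ → ℂ) =ᵐ[volume.restrict (Set.Icc 0 (Γ.length e))] u e) :
    Γ.IsKirchhoffRep f (g + lam • f) u where
  ae_eq := hf
  contDiffOn e := (h.isEdgeSolution e).contDiffOn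
  continuous := ⟨a, fun e => ⟨h.initial e, h.terminal e⟩⟩
  kirchhoff v := (h.kirchhoff_iff hΓ P hS (hdeg v)).2 (heq v)
  secondDeriv e := by
    refine (h.isEdgeSolution e).secondDeriv.congr (Filter.EventuallyEq.refl _ _) ?_
    filter_upwards [hf e, Lp.coeFn_add (g e) (lam • f e), Lp.coeFn_smul lam (f e)] with x h1 h2 h3
    change _ = -((g e + lam • f e : Γ.EdgeL2 e) : ℝ → ℂ) x
    rw [h2, Pi.add_apply, h3, Pi.smul_apply, h1, smul_eq_mul, add_comm]

theorem IsKirchhoffRep.exists_isEdgewiseSolution [G.LocallyFinite] {f h : Γ.L2}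
    (hr : Γ.IsKirchhoffRep f h u) (lam : ℂ) :
    ∃ a, Γ.IsEdgewiseSolution lam (h - lam • f) u a := by
  obtain ⟨a, ha⟩ := hr.continuous
  refine ⟨a, fun e => ⟨hr.contDiffOn e, ?_⟩, fun e => (ha e).1, fun e => (ha e).2⟩
  refine (hr.secondDeriv e).congr (Filter.EventuallyEq.refl _ _) ?_
  filter_upwards [hr.ae_eq e, Lp.coeFn_sub (h e) (lam • f e), Lp.coeFn_smul lam (f e)]
    with x h1 h2 h3
  change -((h e : Γ.EdgeL2 e) : ℝ → ℂ) x =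
    -(lam * u e x + ((h e - lam • f e : Γ.EdgeL2 e) : ℝ → ℂ) x)
  rw [h2, Pi.sub_apply, h3, Pi.smul_apply, h1, smul_eq_mul]
  ring

/-- A vertex value occurs once for each incident edge, which is the origin of the weight `deg`. -/
theorem IsEdgewiseSolution.tsum_boundary_eq [G.LocallyFinite]
    (h : Γ.IsEdgewiseSolution lam g u a) :
    ∑' e, (‖u e 0‖ₑ ^ 2 + ‖u e (Γ.length e)‖ₑ ^ 2) =
      ∑' v : V, (G.degree v : ℝ≥0∞) * ‖a v‖ₑ ^ 2 := by
  simp only [h.initial, h.terminal]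
  refine (Γ.tsum_edge_eq_tsum_vertex fun d => ‖a d.fst‖ₑ ^ 2).trans (tsum_congr fun v => ?_)
  change ∑ w : G.neighborSet v, ‖a v‖ₑ ^ 2 = _
  rw [Finset.sum_const, Finset.card_univ, SimpleGraph.card_neighborSet_eq_degree, nsmul_eq_mul]

end

/-! ### Estimates and constructions on the whole graph. -/

theorem exists_vertexSource_le [G.LocallyFinite] {lam : ℂ} {C S : ℝ → ℂ}
    (hΓ : Γ.IsEquilateral) (P : FundamentalPair lam C S) :
    ∃ K : ℝ≥0∞, K ≠ ⊤ ∧ ∀ g : Γ.L2,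
      ∑' v : V, (G.degree v : ℝ≥0∞) * ‖Γ.vertexSource C S g v‖ₑ ^ 2 ≤ K * ‖g‖ₑ ^ 2 := by
  obtain ⟨K, hK, h⟩ := exists_source_le_eLpNorm P
  have hd : ∀ (g : Γ.L2) d, ‖Γ.dartSource C S g d‖ₑ ^ 2 ≤ K * ‖g (dartEdge d)‖ₑ ^ 2 := by
    intro g d
    have := h (hΓ (dartEdge d)) (Lp.memLp (g (dartEdge d)))
    rw [Lp.enorm_def]
    unfold dartSource
    split_ifs
    · exact this.1
    · exact this.2
  refine ⟨K * 2, by finiteness, fun g => ?_⟩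
  calc ∑' v : V, (G.degree v : ℝ≥0∞) * ‖Γ.vertexSource C S g v‖ₑ ^ 2
      ≤ ∑' v : V, ∑ w : G.neighborSet v, ‖Γ.dartSource C S g (G.dartOfNeighborSet v w)‖ₑ ^ 2 := by
        refine ENNReal.tsum_le_tsum fun v => ?_
        have := degree_mul_enorm_average_sq_le (Finset.univ : Finset (G.neighborSet v))
          fun w => Γ.dartSource C S g (G.dartOfNeighborSet v w)
        rwa [Finset.card_univ, SimpleGraph.card_neighborSet_eq_degree] at this
    _ = ∑' e : G.edgeSet, (‖Γ.dartSource C S g (Γ.orient e)‖ₑ ^ 2 +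
          ‖Γ.dartSource C S g (Γ.orient e).symm‖ₑ ^ 2) :=
        (Γ.tsum_edge_eq_tsum_vertex fun d => ‖Γ.dartSource C S g d‖ₑ ^ 2).symm
    -- The factor `2` counts the two darts of an edge.
    _ ≤ ∑' e : G.edgeSet, K * 2 * ‖g e‖ₑ ^ 2 := by
        refine ENNReal.tsum_le_tsum fun e => ?_
        have h1 := hd g (Γ.orient e)
        have h2 := hd g (Γ.orient e).symm
        rw [dartEdge_symm] at h2
        rw [Γ.dartEdge_orient] at h1 h2
        exact (add_le_add h1 h2).trans (le_of_eq (by ring))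
    _ = K * 2 * ‖g‖ₑ ^ 2 := by rw [ENNReal.tsum_mul_left, tsum_enorm_sq_eq]

theorem exists_boundary_le [G.LocallyFinite] (hΓ : Γ.IsEquilateral) (lam : ℂ) :
    ∃ K : ℝ≥0∞, K ≠ ⊤ ∧ ∀ {g f : Γ.L2} {u : G.edgeSet → ℝ → ℂ} {a : V → ℂ},
      Γ.IsEdgewiseSolution lam g u a →
      (∀ e, (f e : ℝ → ℂ) =ᵐ[volume.restrict (Set.Icc 0 (Γ.length e))] u e) →
      ∑' v : V, (G.degree v : ℝ≥0∞) * ‖a v‖ₑ ^ 2 ≤ K * (‖f‖ₑ ^ 2 + ‖g‖ₑ ^ 2) := by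
  obtain ⟨K, hK, h⟩ := exists_boundary_le_eLpNorm lam
  refine ⟨K, hK, fun {g f u a} hs hf => ?_⟩
  rw [← hs.tsum_boundary_eq, ← tsum_enorm_sq_eq, ← tsum_enorm_sq_eq, ← ENNReal.tsum_add,
    ← ENNReal.tsum_mul_left]
  refine ENNReal.tsum_le_tsum fun e => ?_
  rw [Lp.enorm_def, Lp.enorm_def, eLpNorm_congr_ae (hf e)]
  exact h (hΓ e) (Lp.memLp _) (hs.isEdgeSolution e)

theorem exists_tsum_le_boundary [G.LocallyFinite] {lam : ℂ} {C S : ℝ → ℂ} (hΓ : Γ.IsEquilateral)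
    (P : FundamentalPair lam C S) (hS : S 1 ≠ 0) :
    ∃ K : ℝ≥0∞, K ≠ ⊤ ∧ ∀ {g : Γ.L2} {u : G.edgeSet → ℝ → ℂ} {a : V → ℂ},
      Γ.IsEdgewiseSolution lam g u a →
      ∑' e, eLpNorm (u e) 2 (volume.restrict (Set.Icc 0 (Γ.length e))) ^ 2 ≤
        K * (∑' v : V, (G.degree v : ℝ≥0∞) * ‖a v‖ₑ ^ 2 + ‖g‖ₑ ^ 2) := by
  obtain ⟨K, hK, h⟩ := exists_eLpNorm_le_boundary P hS
  refine ⟨K, hK, fun {g u a} hs => ?_⟩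
  rw [← hs.tsum_boundary_eq, ← tsum_enorm_sq_eq, ← ENNReal.tsum_add, ← ENNReal.tsum_mul_left]
  refine ENNReal.tsum_le_tsum fun e => ?_
  rw [Lp.enorm_def]
  exact h (hΓ e) (Lp.memLp _) (hs.isEdgeSolution e)

theorem exists_isEdgewiseSolution {lam : ℂ} {C S : ℝ → ℂ} (hΓ : Γ.IsEquilateral)
    (P : FundamentalPair lam C S) (hS : S 1 ≠ 0) (g : Γ.L2) (a : V → ℂ) :
    ∃ u, Γ.IsEdgewiseSolution lam g u a := by
  choose u hu h0 h1 using fun e => exists_isEdgeSolution P hS (hΓ e) (Lp.memLp (g e))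
    (a (Γ.orient e).fst) (a (Γ.orient e).snd)
  exact ⟨u, hu, h0, h1⟩

/-- A solution of the vertex equation gives rise to a solution on the metric graph. -/
theorem exists_isKirchhoffRep [G.LocallyFinite] {lam : ℂ} {C S : ℝ → ℂ} (hΓ : Γ.IsEquilateral)
    (P : FundamentalPair lam C S) (hS : S 1 ≠ 0) (hdeg : ∀ v, G.degree v ≠ 0) (g : Γ.L2)
    {a : V → ℂ} (ha : ∑' v : V, (G.degree v : ℝ≥0∞) * ‖a v‖ₑ ^ 2 ≠ ⊤)
    (heq : ∀ v, normLap G a v - (1 - C 1) * a v = Γ.vertexSource C S g v) :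
    ∃ (f : Γ.L2) (u : G.edgeSet → ℝ → ℂ), Γ.IsEdgewiseSolution lam g u a ∧
      Γ.IsKirchhoffRep f (g + lam • f) u := by
  obtain ⟨u, hu⟩ := Γ.exists_isEdgewiseSolution hΓ P hS g a
  obtain ⟨K, hK, h⟩ := Γ.exists_tsum_le_boundary hΓ P hS
  have hfin := (h hu).trans_lt (by finiteness)
  have hm : ∀ e, MemLp (u e) 2 (volume.restrict (Set.Icc 0 (Γ.length e))) := fun e => by
    have hc := (hu.isEdgeSolution e).contDiffOn.continuousOn
    rw [hΓ e] at hc ⊢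
    exact memLp_of_continuousOn hc
  have hmem : Memℓp (fun e => (hm e).toLp : ∀ e, Γ.EdgeL2 e) 2 := by
    refine memℓp_of_tsum_enorm_sq (ne_of_lt ?_)
    refine lt_of_le_of_lt (le_of_eq (tsum_congr fun e => ?_)) hfin
    rw [Lp.enorm_def, eLpNorm_congr_ae (hm e).coeFn_toLp]
  exact ⟨⟨_, hmem⟩, u, hu, hu.isKirchhoffRep hΓ P hS hdeg heq fun e => (hm e).coeFn_toLp⟩

/-- Every square summable function on the vertices arises from a source term. -/
theorem exists_vertexSource_eq [G.LocallyFinite] {lam : ℂ} {C S : ℝ → ℂ} (hΓ : Γ.IsEquilateral)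
    (P : FundamentalPair lam C S) (hdeg : ∀ v, G.degree v ≠ 0)
    {b : V → ℂ} (hb : ∑' v : V, (G.degree v : ℝ≥0∞) * ‖b v‖ₑ ^ 2 ≠ ⊤) :
    ∃ g : Γ.L2, ∀ v, Γ.vertexSource C S g v = S 1 * b v := by
  obtain ⟨K, hK, h⟩ := exists_source_lp P
  choose γ hi ht hγ using fun e =>
    h (hΓ e) (b (Γ.orient e).fst) (b (Γ.orient e).snd)
  have hmem : Memℓp (γ : ∀ e, Γ.EdgeL2 e) 2 := by
    refine memℓp_of_tsum_enorm_sq (ne_of_lt ?_)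
    refine (ENNReal.tsum_le_tsum hγ).trans_lt ?_
    have e1 := Γ.tsum_edge_eq_tsum_vertex fun d => ‖b d.fst‖ₑ ^ 2
    change ∑' e, (‖b (Γ.orient e).fst‖ₑ ^ 2 + ‖b (Γ.orient e).snd‖ₑ ^ 2) =
      ∑' v, ∑ w : G.neighborSet v, ‖b v‖ₑ ^ 2 at e1
    simp only [Finset.sum_const, Finset.card_univ, SimpleGraph.card_neighborSet_eq_degree,
      nsmul_eq_mul] at e1
    rw [ENNReal.tsum_mul_left, e1]
    finiteness
  refine ⟨⟨γ, hmem⟩, fun v => ?_⟩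
  -- All darts leaving `v` contribute the same value, so the average over the neighbors is this
  -- value.
  have hd : ∀ d, Γ.dartSource C S ⟨γ, hmem⟩ d = S 1 * b d.fst := fun d => by
    unfold dartSource
    split_ifs with hd
    · exact (hi _).trans (by rw [hd])
    · exact (ht _).trans (by rw [(Γ.orient_dartEdge d).resolve_left hd]; rfl)
  have hv' : (G.degree v : ℂ) ≠ 0 := by exact_mod_cast hdeg v
  rw [vertexSource, Finset.sum_congr rfl fun w _ => hd _]
  change _ * ∑ w : G.neighborSet v, S 1 * b v = _
  rw [Finset.sum_const, Finset.card_univ, SimpleGraph.card_neighborSet_eq_degree, nsmul_eq_mul]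
  field_simp

/-! ### The spectra of the two operators -/

section

variable {V : Type*} {G : SimpleGraph V} (Γ : MetricGraph G) [G.LocallyFinite]
  {lam : ℂ} {C S : ℝ → ℂ}

theorem exists_isKirchhoffRep_of_mem_domain (x : Γ.kirchhoffLaplacian.domain) :
    ∃ u, Γ.IsKirchhoffRep (x : Γ.L2) (Γ.kirchhoffLaplacian x) u :=
  (Γ.mem_graph_kirchhoffLaplacian _ _).1 (LinearPMap.mem_graph _ x)

theorem exists_mem_domain_of_isKirchhoffRep {f g : Γ.L2} {u : G.edgeSet → ℝ → ℂ}
    (h : Γ.IsKirchhoffRep f (g + lam • f) u) :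
    ∃ x : Γ.kirchhoffLaplacian.domain, (x : Γ.L2) = f ∧
      Γ.kirchhoffLaplacian x - lam • (x : Γ.L2) = g := by
  obtain ⟨x, hx, hAx⟩ := (LinearPMap.mem_graph_iff _).1
    ((Γ.mem_graph_kirchhoffLaplacian _ _).2 ⟨u, h⟩)
  exact ⟨x, hx, by rw [hAx, hx]; exact add_sub_cancel_right _ _⟩

variable [MeasurableSpace V] [DiscreteMeasurableSpace V]

/-- The vertex equation is solved by `R`, and its solution is extended into the edges. Conversely,
the vertex values of any `x` in the domain are `R` applied to the vertex source of `(H - lam) x`,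
which yields the bound. -/
theorem mem_opResolventSet_of_isUnit (hΓ : Γ.IsEquilateral) (P : FundamentalPair lam C S)
    (hS : S 1 ≠ 0) (hdeg : ∀ v, G.degree v ≠ 0)
    (hu : IsUnit (algebraMap ℂ (VertexL2 G →L[ℂ] VertexL2 G) (1 - C 1) - normalizedLaplacian G)) :
    lam ∈ opResolventSet Γ.kirchhoffLaplacian := by
  obtain ⟨U, hU⟩ := hu
  -- `U` is `(1 - C 1) - h`, so the inverse of `h - (1 - C 1)` carries a minus sign.
  set R : VertexL2 G →L[ℂ] VertexL2 G := -(↑U⁻¹ : VertexL2 G →L[ℂ] VertexL2 G) with hR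
  have hUx : ∀ F, (U : VertexL2 G →L[ℂ] VertexL2 G) F =
      -(normalizedLaplacian G F - (1 - C 1) • F) := fun F => by
    rw [hU, neg_sub]
    rfl
  have hright : ∀ F, normalizedLaplacian G (R F) - (1 - C 1) • R F = F := fun F => by
    have h1 := hUx (R F)
    rw [hR, neg_apply, map_neg, neg_inj] at h1
    have h2 := DFunLike.congr_fun (U.mul_inv) F
    rw [hR, neg_apply, ← h1]
    exact h2
  have hleft : ∀ F, R (normalizedLaplacian G F - (1 - C 1) • F) = F := fun F => by
    have h2 := DFunLike.congr_fun (U.inv_mul) F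
    rw [← neg_neg (normalizedLaplacian G F - (1 - C 1) • F), ← hUx, hR, map_neg,
      neg_apply, neg_neg]
    exact h2
  obtain ⟨K₁, hK₁, hsource⟩ := Γ.exists_vertexSource_le hΓ P
  obtain ⟨K₂, hK₂, hbdry⟩ := Γ.exists_boundary_le hΓ lam
  obtain ⟨K₃, hK₃, hsum⟩ := Γ.exists_tsum_le_boundary hΓ P hS
  have hfin : ∀ g : Γ.L2, ∑' v : V, (G.degree v : ℝ≥0∞) * ‖Γ.vertexSource C S g v‖ₑ ^ 2 ≠ ⊤ :=
    fun g => ne_top_of_le_ne_top (by finiteness) (hsource g)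
  refine mem_opResolventSet_of_bound (K := K₃ * (‖R‖ₑ ^ 2 * K₁ + 1)) (fun g => ?_)
    (by finiteness) fun x => ?_
  · obtain ⟨p, hp⟩ := exists_vertexL2_eq hdeg (hfin g)
    obtain ⟨f, u, -, hrep⟩ := Γ.exists_isKirchhoffRep hΓ P hS hdeg g (a := R p)
      (by rw [← enorm_vertexL2_sq]; finiteness)
      (fun v => by rw [← normalizedLaplacian_sub_smul_apply hdeg, hright, hp])
    obtain ⟨x, -, hx⟩ := Γ.exists_mem_domain_of_isKirchhoffRep hrep
    exact ⟨x, hx⟩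
  · obtain ⟨u, hrep⟩ := Γ.exists_isKirchhoffRep_of_mem_domain x
    obtain ⟨a, ha⟩ := hrep.exists_isEdgewiseSolution lam
    set g : Γ.L2 := Γ.kirchhoffLaplacian x - lam • (x : Γ.L2) with hg
    -- The trace estimate serves only to place `a` in `ℓ²(V; deg)`; the quantitative bound comes
    -- from `R`, as `x` itself must not appear on the right side.
    have hafin := ne_top_of_le_ne_top (by finiteness) (hbdry ha hrep.ae_eq)
    obtain ⟨A, hA⟩ := exists_vertexL2_eq hdeg hafin
    obtain ⟨p, hp⟩ := exists_vertexL2_eq hdeg (hfin g)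
    obtain rfl : (A : V → ℂ) = a := funext hA
    have hAp : normalizedLaplacian G A - (1 - C 1) • A = p :=
      Lp.ext (Filter.Eventually.of_forall fun v => by
        rw [normalizedLaplacian_sub_smul_apply hdeg, hp]
        exact (ha.kirchhoff_iff hΓ P hS (hdeg v)).1 (hrep.kirchhoff v))
    have hAR : ‖A‖ₑ ≤ ‖R‖ₑ * ‖p‖ₑ := by
      rw [← hleft A, hAp]
      exact R.le_opENorm p
    have hpg : ‖p‖ₑ ^ 2 ≤ K₁ * ‖g‖ₑ ^ 2 := by
      rw [enorm_vertexL2_sq]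
      simp only [hp]
      exact hsource g
    have hx := hsum ha
    rw [← enorm_vertexL2_sq] at hx
    calc ‖(x : Γ.L2)‖ₑ ^ 2 = ∑' e, ‖(x : Γ.L2) e‖ₑ ^ 2 := (tsum_enorm_sq_eq _).symm
      _ = ∑' e, eLpNorm (u e) 2 (volume.restrict (Set.Icc 0 (Γ.length e))) ^ 2 :=
          tsum_congr fun e => by rw [Lp.enorm_def, eLpNorm_congr_ae (hrep.ae_eq e)]
      _ ≤ K₃ * (‖A‖ₑ ^ 2 + ‖g‖ₑ ^ 2) := hx
      _ ≤ K₃ * ((‖R‖ₑ * ‖p‖ₑ) ^ 2 + ‖g‖ₑ ^ 2) := by gcongr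
      _ ≤ K₃ * (‖R‖ₑ ^ 2 * (K₁ * ‖g‖ₑ ^ 2) + ‖g‖ₑ ^ 2) := by
          rw [mul_pow]
          gcongr
      _ = K₃ * (‖R‖ₑ ^ 2 * K₁ + 1) * ‖g‖ₑ ^ 2 := by ring

/-- A kernel vector on the vertices extends to a solution with `g = 0`, which is zero, so its trace
vanishes. For surjectivity, a prescribed `b` is realized as a vertex source, and the vertex values
of the solution on the metric graph solve the vertex equation. -/
theorem isUnit_of_mem_opResolventSet (hΓ : Γ.IsEquilateral) (P : FundamentalPair lam C S)
    (hS : S 1 ≠ 0) (hdeg : ∀ v, G.degree v ≠ 0)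
    (hlam : lam ∈ opResolventSet Γ.kirchhoffLaplacian) :
    IsUnit (algebraMap ℂ (VertexL2 G →L[ℂ] VertexL2 G) (1 - C 1) - normalizedLaplacian G) := by
  obtain ⟨R, hR₁, hR₂⟩ := hlam
  set T := algebraMap ℂ (VertexL2 G →L[ℂ] VertexL2 G) (1 - C 1) - normalizedLaplacian G with hT
  have hTx : ∀ F, T F = -(normalizedLaplacian G F - (1 - C 1) • F) := fun F => by
    rw [neg_sub]
    rfl
  obtain ⟨K, hK, hbdry⟩ := Γ.exists_boundary_le hΓ lam
  -- On the Banach space `VertexL2 G` a bijective bounded operator has a bounded inverse.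
  rw [ContinuousLinearMap.isUnit_iff_bijective]
  constructor
  · rw [injective_iff_map_eq_zero]
    intro F hF
    rw [hTx, neg_eq_zero] at hF
    -- The bound of `exists_vertexSource_le` at `g = 0` forces every term of the weighted sum to
    -- vanish.
    have h0 : ∀ v, Γ.vertexSource C S 0 v = 0 := fun v => by
      obtain ⟨K₁, -, hsource⟩ := Γ.exists_vertexSource_le hΓ P
      have h1 := hsource 0
      rw [enorm_zero, zero_pow two_ne_zero, mul_zero, nonpos_iff_eq_zero,
        ENNReal.tsum_eq_zero] at h1
      have h2 := h1 v
      rw [mul_eq_zero, or_iff_right (by exact_mod_cast hdeg v), sq_eq_zero_iff, enorm_eq_zero] at h2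
      exact h2
    obtain ⟨f, u, hu, hrep⟩ := Γ.exists_isKirchhoffRep hΓ P hS hdeg 0 (a := F)
      (by rw [← enorm_vertexL2_sq]; finiteness)
      (fun v => by
        rw [← normalizedLaplacian_sub_smul_apply hdeg, hF, h0]
        exact (ae_degMeasure G).1 (Lp.coeFn_zero ℂ 2 (degMeasure G)) v (hdeg v))
    obtain ⟨x, hxf, hx⟩ := Γ.exists_mem_domain_of_isKirchhoffRep hrep
    have hf0 : f = 0 := by rw [← hxf, ← hR₂ x, hx, map_zero]
    have := hbdry hu hrep.ae_eq
    rw [← enorm_vertexL2_sq, hf0, enorm_zero, zero_pow two_ne_zero, add_zero, mul_zero,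
      nonpos_iff_eq_zero, sq_eq_zero_iff, enorm_eq_zero] at this
    exact this
  · intro b
    obtain ⟨g, hg⟩ := Γ.exists_vertexSource_eq hΓ P hdeg (b := b)
      (by rw [← enorm_vertexL2_sq]; finiteness)
    obtain ⟨x, -, hx⟩ := hR₁ g
    obtain ⟨u, hrep⟩ := Γ.exists_isKirchhoffRep_of_mem_domain x
    obtain ⟨a, ha⟩ := hrep.exists_isEdgewiseSolution lam
    rw [hx] at ha
    obtain ⟨A, hA⟩ := exists_vertexL2_eq hdeg
      (ne_top_of_le_ne_top (by finiteness) (hbdry ha hrep.ae_eq))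
    obtain rfl : (A : V → ℂ) = a := funext hA
    have hAb : normalizedLaplacian G A - (1 - C 1) • A = S 1 • b :=
      Lp.ext_iff.2 ((ae_degMeasure G).2 fun v hv => by
        rw [normalizedLaplacian_sub_smul_apply hdeg,
          (ha.kirchhoff_iff hΓ P hS (hdeg v)).1 (hrep.kirchhoff v), hg,
          (ae_degMeasure G).1 (Lp.coeFn_smul (S 1) b) v hv]
        rfl)
    -- The source realizes `S 1 • b` rather than `b`, and `T` is the negative of `h - (1 - C 1)`.
    refine ⟨-(S 1)⁻¹ • A, ?_⟩
    rw [map_smul, hTx, hAb, neg_smul, smul_neg, neg_neg, smul_smul, inv_mul_cancel₀ hS, one_smul]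

end

end MetricGraph

end QuantumGraph

theorem theorem3 {V : Type*} [Countable V] [Nontrivial V]
    [MeasurableSpace V] [DiscreteMeasurableSpace V]
    (G : SimpleGraph V) [G.LocallyFinite] (hG : G.Connected)
    (Γ : QuantumGraph.MetricGraph G) (hΓ : Γ.IsEquilateral)
    (lam : ℝ) (hlam : 0 ≤ lam) (hlam' : ∀ n : ℕ, 1 ≤ n → lam ≠ (Real.pi * n) ^ 2) :
    (lam : ℂ) ∈ QuantumGraph.opSpectrum Γ.kirchhoffLaplacian ↔
      ((1 - Real.cos (Real.sqrt lam) : ℝ) : ℂ) ∈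
        spectrum ℂ (QuantumGraph.normalizedLaplacian G) := by
  obtain ⟨C, S, P, hC, hS⟩ := QuantumGraph.exists_fundamentalPair hlam hlam'
  -- Connectedness with at least two vertices excludes isolated vertices, where neither the mass
  -- `deg v` nor the factor `1 / deg v` would be meaningful.
  have hdeg : ∀ v, G.degree v ≠ 0 := fun v =>
    (hG.preconnected.degree_pos_of_nontrivial v).ne'
  rw [Complex.ofReal_sub, Complex.ofReal_one, ← hC, spectrum.mem_iff]
  exact not_congr ⟨Γ.isUnit_of_mem_opResolventSet hΓ P hS hdeg,
    Γ.mem_opResolventSet_of_isUnit hΓ P hS hdeg⟩
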